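/- Let $K$ be a field, $\Gamma$ a finite quiver, $d>2$ an integer, and let $I$ be a two-sided ideal of the path algebra $K\Gamma$ generated by a set of paths each of which has length $2$ or $d$. Put $\Lambda=K\Gamma/I$ with the grading induced by path length, let $J$ be the ideal of $K\Gamma$ generated by the arrows, and regard the left $\Lambda$-module $\Lambda_0=\Lambda/(J/I)$ as a graded module concentrated in degree $0$. Let $$\cdots\to P^2\to P^1\to P^0\to\Lambda_0\to 0$$ be a minimal graded projective resolution of $\Lambda_0$, that is, an exact sequence of $\mathbb Z$-graded projective left $\Lambda$-modules and homomorphisms of degree $0$ such that for every $n\ge 1$ the image of $P^n$ in $P^{n-1}$ is contained in $(J/I)P^{n-1}$. Define $\delta(n)=\frac n2 d$ for even $n\ge 0$ and $\delta(n)=\frac{n-1}2 d+1$ for odd $n$. An algebra $K\Gamma/I$ is called $2$-$d$-determined if $I$ can be generated by homogeneous elements of degrees $2$ and $d$ and if, in a minimal graded projective resolution of $\Lambda_0$, for every $n\ge 0$ the $n$-th module can be generated by homogeneous elements of degrees at least $n$ and at most $\delta(n)$. Then the following statements are equivalent: 1. The algebra $\Lambda$ is $2$-$d$-determined. 2. $P^3$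 can be generated by homogeneous elements of degrees at most $d+1$. -/

import Mathlib

universe u v w

noncomputable section

/-- The paths of a quiver, each with its origin and its terminus
(the vertices are the paths of length zero). -/
abbrev QuiverPath (V : Type v) [Quiver.{w} V] : Type (max v w) :=
  Σ a b : V, Quiver.Path a b

/-- The length of a path. -/
def QuiverPath.length {V : Type v} [Quiver.{w} V] (p : QuiverPath V) : ℕ :=
  p.2.2.length

/-- The path algebra `KΓ`, whose underlying vector space has the paths as a basis. -/
def PathAlgebra (K : Type u) (V : Type v) [Field K] [Quiver.{w} V] : Type (max u v w) :=
  QuiverPath V →₀ K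

namespace PathAlgebra

variable (K : Type u) (V : Type v) [Field K] [Quiver.{w} V]

instance instAddCommGroup : AddCommGroup (PathAlgebra K V) :=
  inferInstanceAs (AddCommGroup (QuiverPath V →₀ K))

instance instModule : Module K (PathAlgebra K V) :=
  inferInstanceAs (Module K (QuiverPath V →₀ K))

variable {V}

/-- A path, as a basis element of the path algebra. -/
def ofPath (p : QuiverPath V) : PathAlgebra K V := Finsupp.single p 1

open Classical in
/-- The product of two paths: `pq` is "first `p`, then `q`" if `p` ends where `q` begins,
and zero otherwise. -/
def pathMul (p q : QuiverPath V) : PathAlgebra K V :=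
  if h : p.2.1 = q.1 then ofPath K ⟨p.1, q.2.1, p.2.2.comp (q.2.2.cast h.symm rfl)⟩ else 0

theorem pathMul_comp {a b c : V} (p : Quiver.Path a b) (q : Quiver.Path b c) :
    pathMul K ⟨a, b, p⟩ ⟨b, c, q⟩ = ofPath K ⟨a, c, p.comp q⟩ := by
  simp [pathMul]

theorem pathMul_of_ne {p q : QuiverPath V} (h : p.2.1 ≠ q.1) : pathMul K p q = 0 := by
  simp [pathMul, h]

/-- The left multiplication by a path, extended linearly. -/
def mulLeftPath (p : QuiverPath V) : PathAlgebra K V →ₗ[K] PathAlgebra K V :=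
  Finsupp.linearCombination K (M := PathAlgebra K V) (pathMul K p)

variable (V) in
/-- Multiplication of the path algebra, as the bilinear extension of the product of paths. -/
def mulHom : PathAlgebra K V →ₗ[K] PathAlgebra K V →ₗ[K] PathAlgebra K V :=
  Finsupp.linearCombination K (M := PathAlgebra K V →ₗ[K] PathAlgebra K V) (mulLeftPath K)

theorem mulLeftPath_ofPath (p q : QuiverPath V) :
    mulLeftPath K p (ofPath K q) = pathMul K p q :=
  (Finsupp.linearCombination_single K (1 : K) q).trans (one_smul K _)

theorem mulHom_ofPath (p : QuiverPath V) : mulHom K V (ofPath K p) = mulLeftPath K p :=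
  (Finsupp.linearCombination_single K (1 : K) p).trans (one_smul K _)

instance instMul : Mul (PathAlgebra K V) := ⟨fun x y => mulHom K V x y⟩

instance instOne [Fintype V] : One (PathAlgebra K V) :=
  ⟨∑ v : V, ofPath K ⟨v, v, Quiver.Path.nil⟩⟩

variable {K}

theorem mul_def (x y : PathAlgebra K V) : x * y = mulHom K V x y := rfl

theorem one_def [Fintype V] :
    (1 : PathAlgebra K V) = ∑ v : V, ofPath K ⟨v, v, Quiver.Path.nil⟩ := rfl

theorem ofPath_mul_ofPath (p q : QuiverPath V) :
    ofPath K p * ofPath K q = pathMul K p q := by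
  rw [mul_def, mulHom_ofPath, mulLeftPath_ofPath]

theorem induction {motive : PathAlgebra K V → Prop} (x : PathAlgebra K V) (h0 : motive 0)
    (hadd : ∀ y z, motive y → motive z → motive (y + z))
    (hsmul : ∀ (c : K) (p : QuiverPath V), motive (c • ofPath K p)) : motive x := by
  refine Finsupp.induction_linear (motive := motive) x h0 hadd ?_
  intro p c
  have h : c • ofPath K p = (Finsupp.single p c : QuiverPath V →₀ K) :=
    Finsupp.smul_single_one p c
  rw [← h]
  exact hsmul c p

theorem left_distrib' (x y z : PathAlgebra K V) : x * (y + z) = x * y + x * z := by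
  simp only [mul_def, map_add]

theorem right_distrib' (x y z : PathAlgebra K V) : (x + y) * z = x * z + y * z := by
  simp only [mul_def, map_add, LinearMap.add_apply]

theorem smul_mul' (c : K) (x y : PathAlgebra K V) : (c • x) * y = c • (x * y) := by
  simp only [mul_def, map_smul, LinearMap.smul_apply]

theorem mul_smul' (c : K) (x y : PathAlgebra K V) : x * (c • y) = c • (x * y) := by
  simp only [mul_def, map_smul]

theorem zero_mul' (x : PathAlgebra K V) : 0 * x = 0 := by
  simp only [mul_def, map_zero, LinearMap.zero_apply]

theorem mul_zero' (x : PathAlgebra K V) : x * 0 = 0 := by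
  simp only [mul_def, map_zero]

theorem ofPath_assoc (p q r : QuiverPath V) :
    ofPath K p * ofPath K q * ofPath K r = ofPath K p * (ofPath K q * ofPath K r) := by
  obtain ⟨a, b, p⟩ := p
  obtain ⟨b', c, q⟩ := q
  obtain ⟨c', e, r⟩ := r
  simp only [ofPath_mul_ofPath]
  by_cases hb : b = b'
  · subst hb
    rw [pathMul_comp, ofPath_mul_ofPath]
    by_cases hc : c = c'
    · subst hc
      rw [pathMul_comp, pathMul_comp, ofPath_mul_ofPath, pathMul_comp, Quiver.Path.comp_assoc]
    · rw [pathMul_of_ne K (by exact hc), pathMul_of_ne K (by exact hc), mul_zero']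
  · rw [pathMul_of_ne K (by exact hb), zero_mul']
    by_cases hc : c = c'
    · subst hc
      rw [pathMul_comp, ofPath_mul_ofPath, pathMul_of_ne K (by exact hb)]
    · rw [pathMul_of_ne K (by exact hc), mul_zero']

theorem mul_assoc' (x y z : PathAlgebra K V) : x * y * z = x * (y * z) := by
  induction x using PathAlgebra.induction with
  | h0 => simp only [zero_mul']
  | hadd x₁ x₂ h₁ h₂ => simp only [right_distrib', h₁, h₂]
  | hsmul c p =>
    induction y using PathAlgebra.induction with
    | h0 => simp only [zero_mul', mul_zero']
    | hadd y₁ y₂ h₁ h₂ => simp only [right_distrib', left_distrib', h₁, h₂]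
    | hsmul c' q =>
      induction z using PathAlgebra.induction with
      | h0 => simp only [mul_zero']
      | hadd z₁ z₂ h₁ h₂ => simp only [left_distrib', h₁, h₂]
      | hsmul c'' r => simp only [smul_mul', mul_smul', ofPath_assoc]

theorem sum_mul' {ι : Type*} (s : Finset ι) (f : ι → PathAlgebra K V) (x : PathAlgebra K V) :
    (∑ i ∈ s, f i) * x = ∑ i ∈ s, f i * x := by
  simp only [mul_def, map_sum, LinearMap.sum_apply]

theorem mul_sum' {ι : Type*} (s : Finset ι) (f : ι → PathAlgebra K V) (x : PathAlgebra K V) :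
    x * (∑ i ∈ s, f i) = ∑ i ∈ s, x * f i := by
  simp only [mul_def, map_sum]

theorem one_mul' [Fintype V] (x : PathAlgebra K V) : 1 * x = x := by
  induction x using PathAlgebra.induction with
  | h0 => exact mul_zero' _
  | hadd x y hx hy => rw [left_distrib', hx, hy]
  | hsmul c p =>
    obtain ⟨a, b, p⟩ := p
    rw [mul_smul', one_def, sum_mul', Finset.sum_eq_single a]
    · rw [ofPath_mul_ofPath, pathMul_comp, Quiver.Path.nil_comp]
    · intro v _ hv
      rw [ofPath_mul_ofPath, pathMul_of_ne K (by exact hv)]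
    · simp

theorem mul_one' [Fintype V] (x : PathAlgebra K V) : x * 1 = x := by
  induction x using PathAlgebra.induction with
  | h0 => exact zero_mul' _
  | hadd x y hx hy => rw [right_distrib', hx, hy]
  | hsmul c p =>
    obtain ⟨a, b, p⟩ := p
    rw [smul_mul', one_def, mul_sum', Finset.sum_eq_single b]
    · rw [ofPath_mul_ofPath, pathMul_comp, Quiver.Path.comp_nil]
    · intro v _ hv
      rw [ofPath_mul_ofPath, pathMul_of_ne K (by exact Ne.symm hv)]
    · simp

instance instRing [Fintype V] : Ring (PathAlgebra K V) :=
  { instAddCommGroup K V with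
    mul := (· * ·)
    one := 1
    left_distrib := left_distrib'
    right_distrib := right_distrib'
    zero_mul := zero_mul'
    mul_zero := mul_zero'
    mul_assoc := mul_assoc'
    one_mul := one_mul'
    mul_one := mul_one' }

instance instAlgebra [Fintype V] : Algebra K (PathAlgebra K V) :=
  Algebra.ofModule smul_mul' (fun c x y => mul_smul' c x y)

variable (K V) in
/-- The homogeneous component of degree `n` in the length grading of `KΓ`. -/
def homogeneous (n : ℕ) : Submodule K (PathAlgebra K V) :=
  Submodule.span K {x | ∃ p : QuiverPath V, p.length = n ∧ x = ofPath K p}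

variable (K) in
/-- The two-sided ideal of `KΓ` generated by a set of paths. -/
def monomialIdeal [Fintype V] (S : Set (QuiverPath V)) : TwoSidedIdeal (PathAlgebra K V) :=
  TwoSidedIdeal.span (ofPath K '' S)

end PathAlgebra

section Quotient

variable {K : Type u} {V : Type v} [Field K] [Fintype V] [Quiver.{w} V]

/-- The algebra `Λ = KΓ/I`. -/
abbrev QuiverAlgebra (I : TwoSidedIdeal (PathAlgebra K V)) : Type (max u v w) :=
  I.ringCon.Quotient

namespace QuiverAlgebra

/-- The projection `KΓ → KΓ/I`. -/
def mk (I : TwoSidedIdeal (PathAlgebra K V)) : PathAlgebra K V →+* QuiverAlgebra I :=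
  I.ringCon.mk'

/-- The ideal `J/I` of `Λ = KΓ/I` generated by the arrows. -/
def arrowIdeal (I : TwoSidedIdeal (PathAlgebra K V)) : Ideal (QuiverAlgebra I) :=
  (TwoSidedIdeal.span
    {x | ∃ p : QuiverPath V, p.length = 1 ∧ x = mk I (PathAlgebra.ofPath K p)}).asIdeal

/-- The left `Λ`-module `Λ₀ = Λ/(J/I)`. -/
abbrev degreeZero (I : TwoSidedIdeal (PathAlgebra K V)) : Type (max u v w) :=
  QuiverAlgebra I ⧸ arrowIdeal I

/-- A minimal graded projective resolution `⋯ → P² → P¹ → P⁰ → Λ₀ → 0` over `Λ = KΓ/I`,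
where `I` is a homogeneous ideal, `Λ` carries the length grading and `Λ₀` is concentrated in
degree zero. -/
structure MinimalGradedResolution (I : TwoSidedIdeal (PathAlgebra K V)) where
  /-- The modules `Pⁿ`. -/
  P : ℕ → Type (max u v w)
  [addCommGroup : ∀ n, AddCommGroup (P n)]
  [module : ∀ n, Module (QuiverAlgebra I) (P n)]
  /-- The homogeneous components of `Pⁿ`. -/
  component : ∀ n, ℤ → AddSubgroup (P n)
  isInternal : ∀ n, DirectSum.IsInternal (component n)
  smul_mem : ∀ (n i : ℕ) (j : ℤ), ∀ x ∈ PathAlgebra.homogeneous K V i,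
    ∀ m ∈ component n j, mk I x • m ∈ component n (i + j)
  projective : ∀ n, Module.Projective (QuiverAlgebra I) (P n)
  /-- The differentials `Pⁿ⁺¹ → Pⁿ`. -/
  d : ∀ n, P (n + 1) →ₗ[QuiverAlgebra I] P n
  d_mem : ∀ (n : ℕ) (j : ℤ), ∀ m ∈ component (n + 1) j, d n m ∈ component n j
  /-- The augmentation `P⁰ → Λ₀`. -/
  ε : P 0 →ₗ[QuiverAlgebra I] degreeZero I
  ε_eq_zero : ∀ j : ℤ, j ≠ 0 → ∀ m ∈ component 0 j, ε m = 0
  ε_surjective : Function.Surjective ε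
  exact_zero : Function.Exact (d 0) ε
  exact_succ : ∀ n, Function.Exact (d (n + 1)) (d n)
  minimal : ∀ n, LinearMap.range (d n) ≤ arrowIdeal I • (⊤ : Submodule (QuiverAlgebra I) (P n))

attribute [instance] MinimalGradedResolution.addCommGroup MinimalGradedResolution.module

/-- `Pⁿ` can be generated by homogeneous elements whose degrees lie in `D`. -/
def MinimalGradedResolution.GeneratedInDegrees {I : TwoSidedIdeal (PathAlgebra K V)}
    (R : MinimalGradedResolution I) (n : ℕ) (D : Set ℤ) : Prop :=
  Submodule.span (QuiverAlgebra I) {m : R.P n | ∃ j ∈ D, m ∈ R.component n j} = ⊤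

/-- The function `δ`: `δ(n) = (n/2)d` for even `n`, `δ(n) = ((n-1)/2)d + 1` for odd `n`. -/
def delta (d n : ℕ) : ℕ := if Even n then n / 2 * d else (n - 1) / 2 * d + 1

/-- `Λ = KΓ/I` is `2`-`d`-determined: `I` can be generated by homogeneous elements of degrees
`2` and `d`, and in a minimal graded projective resolution of `Λ₀` every `Pⁿ` can be generated
in degrees at least `n` and at most `δ(n)`. -/
def IsTwoDDetermined (d : ℕ) (I : TwoSidedIdeal (PathAlgebra K V)) : Prop :=
  (∃ X : Set (PathAlgebra K V),
    (∀ x ∈ X, x ∈ PathAlgebra.homogeneous K V 2 ∨ x ∈ PathAlgebra.homogeneous K V d) ∧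
      I = TwoSidedIdeal.span X) ∧
  ∃ R : MinimalGradedResolution I, ∀ n : ℕ,
    R.GeneratedInDegrees n (Set.Icc (n : ℤ) (delta d n : ℤ))

end QuiverAlgebra

end Quotient

end

/-! For a monomial ideal the minimal resolution of `Λ₀` can be read off from paths. Let `p` be a
path of positive length outside `I`. Distinct paths `b` ending at its origin give distinct products
`bp`, so nothing cancels, and those that kill `p` are the left multiples of the minimal paths `q`
with `qp` in `I` (`mul_pathClass_eq_zero_iff`). No path has two such `q` as suffixes
(`next_suffix_unique`), so the left ideals `Λq` form a direct sum, and the relations of each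
generator `q` are again given by minimal paths. Iterating, `Pⁿ` has one homogeneous generator for
each chain (vertex, arrow, `q₂`, …, `qₙ`) in which every path is minimal for its predecessor, and
its degree is the total length of the chain (`generatedInDegrees_iff`). This holds for every minimal
resolution, so both statements become statements about lengths of chains.

A path that is minimal for an arrow completes it to a generator of `I`, hence has length `1` or `d -
1`. If the chains of `P³` have length at most `d + 1`, a path of length `d - 1` that follows an
arrow can only be followed by an arrow. So from the arrow on, two consecutive paths in a chain have
total length at most `d` (`chains_length_add_length_le`), while `δ` grows by exactly `d` in two
steps. The lower bound `n` holds since every step adds at least one arrow. The converse is `δ(3) = d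
+ 1`.

The passage to an arbitrary resolution needs no finiteness of `Λ` and no lower bound on the
gradings: it rests on the filtration of `Λ` by path length, whose intersection is zero
(`eq_zero_of_mem_order`). -/

noncomputable section

/-! ### Concatenation and suffixes of paths. -/

namespace QuiverPath

variable {V : Type v} [Quiver.{w} V]

/-- The vertex `a`, as a path of length zero. -/
def vertex (a : V) : QuiverPath V := ⟨a, a, Quiver.Path.nil⟩

/-- `IsComp p q r` says that `r` is the path "first `p`, then `q`". -/
inductive IsComp : QuiverPath V → QuiverPath V → QuiverPath V → Prop
  | mk {a b c : V} (p : Quiver.Path a b) (q : Quiver.Path b c) :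
      IsComp ⟨a, b, p⟩ ⟨b, c, q⟩ ⟨a, c, p.comp q⟩

theorem length_vertex (a : V) : (vertex a).length = 0 := rfl

theorem eq_vertex {p : QuiverPath V} (hp : p.length = 0) : p = vertex p.2.1 := by
  obtain ⟨a, b, p⟩ := p
  obtain rfl : a = b := Quiver.Path.eq_of_length_zero p hp
  obtain rfl := Quiver.Path.eq_nil_of_length_zero p hp
  rfl

namespace IsComp

variable {p q r p' q' r' s t : QuiverPath V}

theorem exists_comp (h : p.2.1 = q.1) : ∃ r, IsComp p q r := by
  obtain ⟨a, b, p⟩ := p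
  obtain ⟨b', c, q⟩ := q
  obtain rfl : b = b' := h
  exact ⟨_, mk p q⟩

theorem target_eq (h : IsComp p q r) : p.2.1 = q.1 := by cases h; rfl

theorem target (h : IsComp p q r) : r.2.1 = q.2.1 := by cases h; rfl

theorem source (h : IsComp p q r) : r.1 = p.1 := by cases h; rfl

theorem length (h : IsComp p q r) : r.length = p.length + q.length := by
  cases h
  exact Quiver.Path.length_comp _ _

theorem eq (h : IsComp p q r) (h' : IsComp p q r') : r = r' := by
  cases h; cases h'; rfl

theorem vertex_left (p : QuiverPath V) : IsComp (vertex p.1) p p := by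
  obtain ⟨a, b, p⟩ := p
  have h := mk (Quiver.Path.nil : Quiver.Path a a) p
  rwa [Quiver.Path.nil_comp] at h

theorem vertex_right (p : QuiverPath V) : IsComp p (vertex p.2.1) p := by
  obtain ⟨a, b, p⟩ := p
  exact mk p Quiver.Path.nil

theorem eq_of_length_right (h : IsComp p q r) (hq : q.length = 0) : r = p := by
  have hv : q = vertex p.2.1 := by
    obtain ⟨a, b, q⟩ := q
    obtain rfl : a = b := Quiver.Path.eq_of_length_zero q hq
    rw [h.target_eq]
    exact eq_vertex hq
  subst hv
  exact h.eq (vertex_right p)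

theorem eq_of_length_left (h : IsComp p q r) (hp : p.length = 0) : r = q := by
  have hv : p = vertex q.1 := by rw [← h.target_eq]; exact eq_vertex hp
  subst hv
  exact h.eq (vertex_left q)

theorem assoc_right (h : IsComp p q s) (h' : IsComp s r t) :
    ∃ z, IsComp q r z ∧ IsComp p z t := by
  cases h with
  | mk p q =>
    cases h' with
    | mk _ r => exact ⟨_, mk q r, by rw [Quiver.Path.comp_assoc]; exact mk p _⟩

theorem assoc_left (h : IsComp q r s) (h' : IsComp p s t) :
    ∃ z, IsComp p q z ∧ IsComp z r t := by
  cases h with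
  | mk q r =>
    cases h' with
    | mk p _ => exact ⟨_, mk p q, by rw [← Quiver.Path.comp_assoc]; exact mk _ r⟩

theorem exists_suffix (r : QuiverPath V) {k : ℕ} (hk : k ≤ r.length) :
    ∃ p q, IsComp p q r ∧ q.length = k := by
  induction k with
  | zero => exact ⟨r, vertex r.2.1, vertex_right r, rfl⟩
  | succ k ih =>
    obtain ⟨p, q, h, rfl⟩ := ih (by omega)
    have hl := h.length
    obtain ⟨a, b, p⟩ := p
    cases p with
    | nil => change _ = 0 + _ at hl; omega
    | cons p e =>
      cases h with
      | mk _ q =>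
        have hs : (p.cons e).comp q = p.comp (e.toPath.comp q) := by
          rw [← Quiver.Path.comp_assoc, Quiver.Path.comp_toPath_eq_cons]
        refine ⟨⟨_, _, p⟩, ⟨_, _, e.toPath.comp q⟩, hs ▸ mk p _, ?_⟩
        change (e.toPath.comp q).length = q.length + 1
        rw [Quiver.Path.length_comp, Quiver.Path.length_toPath, add_comm]

theorem unique (h : IsComp p q r) (h' : IsComp p' q' r) (hl : q.length = q'.length) :
    p = p' ∧ q = q' := by
  obtain ⟨a, b, p⟩ := p
  obtain ⟨b₀, c, q⟩ := q
  obtain rfl : b = b₀ := h.target_eq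
  obtain ⟨a', b', p'⟩ := p'
  obtain ⟨b₁, c', q'⟩ := q'
  obtain rfl : b' = b₁ := h'.target_eq
  obtain rfl := h.eq (mk p q)
  obtain rfl : a = a' := h'.source
  obtain rfl : c = c' := h'.target
  have e := h'.eq (mk p' q')
  simp only [Sigma.mk.injEq, heq_eq_eq, true_and] at e
  change q.length = q'.length at hl
  clear h h'
  induction q with
  | nil =>
    cases q' with
    | nil => simp only [Quiver.Path.comp_nil] at e; subst e; exact ⟨rfl, rfl⟩
    | cons q' f => simp at hl
  | cons q f ih =>
    cases q' with
    | nil => simp at hl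
    | cons q' f' =>
      simp only [Quiver.Path.comp_cons, Quiver.Path.cons.injEq] at e
      obtain ⟨rfl, h1, h2⟩ := e
      obtain ⟨h3, h4⟩ := ih q' (eq_of_heq h1) (by simpa using hl)
      cases h3
      cases h4
      cases h2
      exact ⟨rfl, rfl⟩

/-- The suffixes of a path are linearly ordered; all later comparisons of overlapping paths go
through this. -/
theorem exists_middle (h : IsComp p q r) (h' : IsComp p' q' r) (hl : q.length ≤ q'.length) :
    ∃ m, IsComp m q q' ∧ IsComp p' m p := by
  obtain ⟨m, q₁, h1, h2⟩ := exists_suffix q' hl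
  obtain ⟨z, h3, h4⟩ := h1.assoc_left h'
  obtain ⟨rfl, rfl⟩ := h.unique h4 h2.symm
  exact ⟨m, h1, h3⟩

end IsComp

/-! ### Paths through `S` and minimal left completions. -/

open IsComp

/-- The paths that pass through a path of the set `S`. -/
def through (S : Set (QuiverPath V)) : Set (QuiverPath V) :=
  {b | ∃ s ∈ S, ∃ u t w, IsComp u s t ∧ IsComp t w b}

/-- For a vertex `p` the arrows ending in `p`; for a path `p` of positive length the minimal
paths `q` outside `through S` such that `qp` is in `through S`. -/
def next (S : Set (QuiverPath V)) (p : QuiverPath V) : Set (QuiverPath V) :=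
  {q | q.2.1 = p.1 ∧ ((p.length = 0 ∧ q.length = 1) ∨
    (p.length ≠ 0 ∧ q ∉ through S ∧ (∃ b ∈ through S, IsComp q p b) ∧
      ∀ u q', IsComp u q' q → q'.length < q.length → ∀ b, IsComp q' p b → b ∉ through S))}

variable {S : Set (QuiverPath V)} {p q r p' q' b : QuiverPath V}

theorem through_of_mem (h : p ∈ S) : p ∈ through S :=
  ⟨p, h, _, _, _, vertex_left p, vertex_right p⟩

theorem through_of_left (h : IsComp p q r) (hp : p ∈ through S) : r ∈ through S := by
  obtain ⟨s, hs, u, t, w, h1, h2⟩ := hp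
  obtain ⟨z, h3, h4⟩ := h2.assoc_right h
  exact ⟨s, hs, u, t, z, h1, h4⟩

theorem through_of_right (h : IsComp p q r) (hq : q ∈ through S) : r ∈ through S := by
  obtain ⟨s, hs, u, t, w, h1, h2⟩ := hq
  obtain ⟨z, h3, h4⟩ := h2.assoc_left h
  obtain ⟨y, h5, h6⟩ := h1.assoc_left h3
  exact ⟨s, hs, y, z, w, h6, h4⟩

theorem two_le_length (hS : ∀ p ∈ S, 2 ≤ p.length) (hp : p ∈ through S) : 2 ≤ p.length := by
  obtain ⟨s, hs, u, t, w, h1, h2⟩ := hp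
  have := hS s hs
  rw [h2.length, h1.length]
  omega

theorem notMem_through_of_mem_next (hS : ∀ p ∈ S, 2 ≤ p.length) (hq : q ∈ next S p) :
    q ∉ through S := by
  obtain ⟨-, ⟨-, h⟩ | ⟨-, h, -⟩⟩ := hq
  · intro hq
    have := two_le_length hS hq
    omega
  · exact h

theorem length_pos_of_mem_next (hp : p ∉ through S) (hq : q ∈ next S p) : 1 ≤ q.length := by
  obtain ⟨-, ⟨-, h⟩ | ⟨-, -, ⟨b, hb, h⟩, -⟩⟩ := hq
  · omega
  · by_contra! hl
    rw [h.eq_of_length_left (by omega)] at hb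
    exact hp hb

/-- If the lengths differed, the shorter suffix would be a proper suffix of the longer one, against
minimality. This is what makes the sum of the left ideals generated by `next S p` direct. -/
theorem next_suffix_unique (hq : q ∈ next S p) (hq' : q' ∈ next S p) (h : IsComp r q b)
    (h' : IsComp r' q' b) : q = q' ∧ r = r' := by
  suffices hl : q.length = q'.length from (h.unique h' hl).symm
  obtain ⟨-, ⟨h0, h1⟩ | ⟨h0, h1, ⟨c, hc, h2⟩, h3⟩⟩ := hq
  · obtain ⟨-, ⟨-, h1'⟩ | ⟨h0', -⟩⟩ := hq'
    · omega
    · omega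
  · obtain ⟨-, ⟨h0', -⟩ | ⟨-, h1', ⟨c', hc', h2'⟩, h3'⟩⟩ := hq'
    · omega
    · rcases lt_trichotomy q.length q'.length with hlt | heq | hlt
      · obtain ⟨m, hm, -⟩ := h.exists_middle h' hlt.le
        exact absurd hc (h3' _ _ hm hlt _ h2)
      · exact heq
      · obtain ⟨m, hm, -⟩ := h'.exists_middle h hlt.le
        exact absurd hc' (h3 _ _ hm hlt _ h2')

/-- Take the shortest suffix of `b` whose product with `p` passes through `S`. -/
theorem exists_next_suffix (hp : p.length ≠ 0) (hb : b ∉ through S) (h : IsComp b p r)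
    (hr : r ∈ through S) : ∃ q ∈ next S p, ∃ t, IsComp t q b := by
  classical
  have hex : ∃ n, ∃ t q c, q.length = n ∧ IsComp t q b ∧ IsComp q p c ∧ c ∈ through S :=
    ⟨_, vertex b.1, b, r, rfl, vertex_left b, h, hr⟩
  obtain ⟨t, q, c, hl, htq, hqp, hc⟩ := Nat.find_spec hex
  refine ⟨q, ⟨hqp.target_eq, Or.inr ⟨hp, fun hq => hb (through_of_right htq hq),
    ⟨c, hc, hqp⟩, fun u q' hu hlt c' hc' hmem => ?_⟩⟩, t, htq⟩
  obtain ⟨z, -, hz⟩ := hu.assoc_left htq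
  exact Nat.find_min hex (hl ▸ hlt) ⟨z, q', c', rfl, hz, hc', hmem⟩

/-- The product `qp` is itself an element of `S`: an occurrence of `s ∈ S` in it must reach its end,
or it would lie inside `q`, and its beginning, or a proper suffix of `q` would do. -/
theorem length_of_mem_next_arrow {d : ℕ} (hd : 2 < d) (hS : ∀ p ∈ S, p.length = 2 ∨ p.length = d)
    (hp : p.length = 1) (hq : q ∈ next S p) : q.length = 1 ∨ q.length = d - 1 := by
  obtain ⟨-, ⟨h0, -⟩ | ⟨-, hq, ⟨b, ⟨s, hs, u, t, w, h1, h2⟩, h3⟩, h4⟩⟩ := hq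
  · omega
  have hw : w.length = 0 := by
    by_contra hw
    obtain ⟨m, -, hm⟩ := h3.exists_middle h2 (by omega)
    exact hq ⟨s, hs, u, t, m, h1, hm⟩
  obtain rfl := h2.eq_of_length_right hw
  have hsl := hS s hs
  obtain ⟨m, hm, hum⟩ := h3.exists_middle h1 (by omega)
  have hl1 := hm.length
  have hl2 := hum.length
  have : ¬ m.length < q.length := fun hlt => h4 u m hum hlt s hm (through_of_mem hs)
  omega

/-! ### Chains and the estimate of their degrees. -/

variable (V) in
/-- A family of paths, each with a degree. -/
structure GradedFamily where
  /-- The index type. -/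
  ι : Type (max v w)
  /-- The paths. -/
  path : ι → QuiverPath V
  /-- The degrees. -/
  deg : ι → ℕ

/-- Every path `p` of the family is replaced by the paths in `next S p`. -/
def GradedFamily.succ (S : Set (QuiverPath V)) (F : GradedFamily V) : GradedFamily V where
  ι := Σ c : F.ι, next S (F.path c)
  path c := c.2
  deg c := F.deg c.1 + (c.2 : QuiverPath V).length

/-- The chains of paths that index the generators of the projective modules in a minimal
resolution: sequences that start with a vertex and go on from `p` to a path in `next S p`,
each with its last path and its total length. -/
def chains (S : Set (QuiverPath V)) : ℕ → GradedFamily V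
  | 0 => ⟨{p : QuiverPath V // p.length = 0}, Subtype.val, fun _ => 0⟩
  | n + 1 => (chains S n).succ S

theorem chains_path_notMem (hS : ∀ p ∈ S, 2 ≤ p.length) (n : ℕ) (c : (chains S n).ι) :
    (chains S n).path c ∉ through S := by
  cases n with
  | zero =>
    intro h
    have h1 := two_le_length hS h
    have h2 : ((chains S 0).path c).length = 0 := c.2
    omega
  | succ n => exact notMem_through_of_mem_next hS c.2.2

theorem le_deg_chains (hS : ∀ p ∈ S, 2 ≤ p.length) (n : ℕ) (c : (chains S n).ι) :
    n ≤ (chains S n).deg c := by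
  induction n with
  | zero => exact Nat.zero_le _
  | succ n ih =>
    have h1 := ih c.1
    have h2 := length_pos_of_mem_next (chains_path_notMem hS n c.1) c.2.2
    exact Nat.add_le_add h1 h2

theorem length_add_length_le_of_arrow {d : ℕ}
    (h3 : ∀ c : (chains S 3).ι, (chains S 3).deg c ≤ d + 1) (hp : p.length = 1) (hq : q ∈ next S p)
    (hr : r ∈ next S q) : q.length + r.length ≤ d := by
  have hp0 : p ∈ next S (vertex p.2.1) := ⟨rfl, Or.inl ⟨rfl, hp⟩⟩
  have h := h3 ⟨⟨⟨⟨vertex p.2.1, rfl⟩, ⟨p, hp0⟩⟩, ⟨q, hq⟩⟩, ⟨r, hr⟩⟩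
  change 0 + p.length + q.length + r.length ≤ d + 1 at h
  omega

/-- The bound on chains of length three propagates because it resets the chain: a path of length `d
- 1` completing an arrow leaves room for an arrow only. The arrow `p` is recorded because the bound
applies to triples starting with an arrow. -/
theorem chains_path_arrow_or {d : ℕ} (hd : 2 < d)
    (hS : ∀ p ∈ S, p.length = 2 ∨ p.length = d)
    (h3 : ∀ c : (chains S 3).ι, (chains S 3).deg c ≤ d + 1) (n : ℕ) (c : (chains S (n + 1)).ι) :
    ((chains S (n + 1)).path c).length = 1 ∨
      (((chains S (n + 1)).path c).length = d - 1 ∧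
        ∃ p, p.length = 1 ∧ (chains S (n + 1)).path c ∈ next S p) := by
  have hS2 : ∀ p ∈ S, 2 ≤ p.length := fun p hp => by have := hS p hp; omega
  induction n with
  | zero =>
    obtain ⟨c, q, hq⟩ := c
    obtain ⟨-, ⟨-, h⟩ | ⟨h, -⟩⟩ := hq
    · exact Or.inl h
    · exact absurd c.2 h
  | succ n ih =>
    obtain ⟨c, q, hq⟩ := c
    change q.length = 1 ∨ (q.length = d - 1 ∧ ∃ p, p.length = 1 ∧ q ∈ next S p)
    rcases ih c with h | ⟨hl, p, hp, hpc⟩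
    · rcases length_of_mem_next_arrow hd hS h hq with h1 | h1
      · exact Or.inl h1
      · exact Or.inr ⟨h1, _, h, hq⟩
    · have h1 := length_add_length_le_of_arrow h3 hp hpc hq
      have h2 := length_pos_of_mem_next (chains_path_notMem hS2 _ c) hq
      left; omega

theorem chains_length_add_length_le {d : ℕ} (hd : 2 < d)
    (hS : ∀ p ∈ S, p.length = 2 ∨ p.length = d)
    (h3 : ∀ c : (chains S 3).ι, (chains S 3).deg c ≤ d + 1) (n : ℕ) (c : (chains S (n + 1)).ι)
    (hq : q ∈ next S ((chains S (n + 1)).path c)) :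
    ((chains S (n + 1)).path c).length + q.length ≤ d := by
  rcases chains_path_arrow_or hd hS h3 n c with h | ⟨hl, p, hp, hpc⟩
  · have := length_of_mem_next_arrow hd hS h hq
    omega
  · exact length_add_length_le_of_arrow h3 hp hpc hq

/-- Induction in steps of two, since only the sum of two consecutive lengths is bounded by `d`. -/
theorem deg_chains_le_delta {d : ℕ} (hd : 2 < d)
    (hS : ∀ p ∈ S, p.length = 2 ∨ p.length = d)
    (h3 : ∀ c : (chains S 3).ι, (chains S 3).deg c ≤ d + 1) (n : ℕ) (c : (chains S n).ι) :
    (chains S n).deg c ≤ QuiverAlgebra.delta d n := by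
  induction n using Nat.twoStepInduction with
  | zero => exact Nat.zero_le _
  | one =>
    obtain ⟨c, q, hq⟩ := c
    obtain ⟨-, ⟨-, h⟩ | ⟨h, -⟩⟩ := hq
    · change 0 + q.length ≤ 0 * d + 1
      omega
    · exact absurd c.2 h
  | more n ih _ =>
    obtain ⟨⟨c, q⟩, r⟩ := c
    have h1 := ih c
    have h2 : q.1.length + r.1.length ≤ d := chains_length_add_length_le hd hS h3 n ⟨c, q⟩ r.2
    change (chains S n).deg c + q.1.length + r.1.length ≤ _
    have h4 : QuiverAlgebra.delta d (n + 2) = QuiverAlgebra.delta d n + d := by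
      unfold QuiverAlgebra.delta
      rcases Nat.even_or_odd' n with ⟨k, rfl | rfl⟩
      · have e1 : Even (2 * k) := ⟨k, by omega⟩
        have e2 : Even (2 * k + 2) := ⟨k + 1, by omega⟩
        rw [if_pos e1, if_pos e2, show (2 * k + 2) / 2 = k + 1 by omega,
          show 2 * k / 2 = k by omega]
        ring
      · have e1 : ¬ Even (2 * k + 1) := by rw [Nat.not_even_iff]; omega
        have e2 : ¬ Even (2 * k + 1 + 2) := by rw [Nat.not_even_iff]; omega
        rw [if_neg e1, if_neg e2, show (2 * k + 1 + 2 - 1) / 2 = k + 1 by omega,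
          show (2 * k + 1 - 1) / 2 = k by omega]
        ring
    omega

end QuiverPath

end

noncomputable section

open QuiverPath (IsComp through next vertex)

/-! ### Coefficients and monomial ideals in the path algebra. -/

namespace PathAlgebra

variable {K : Type u} {V : Type v} [Field K] [Quiver.{w} V]

/-- The coefficient of a path. -/
def coeff (b : QuiverPath V) : PathAlgebra K V →ₗ[K] K :=
  Finsupp.lapply (M := K) b

open Classical in
theorem coeff_ofPath (b p : QuiverPath V) :
    coeff b (ofPath K p) = if p = b then 1 else 0 :=
  Finsupp.single_apply

theorem coeff_ofPath_self (b : QuiverPath V) : coeff b (ofPath K b) = 1 := by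
  rw [coeff_ofPath, if_pos rfl]

theorem coeff_ofPath_of_ne {b p : QuiverPath V} (h : p ≠ b) : coeff b (ofPath K p) = 0 := by
  rw [coeff_ofPath, if_neg h]

/-- Stated for additive subgroups, with all scalars `c`, so that it applies to ideals and to
preimages under merely additive maps. -/
theorem mem_of_coeff {x : PathAlgebra K V} (H : AddSubgroup (PathAlgebra K V))
    (h : ∀ b, coeff b x ≠ 0 → ∀ c : K, c • ofPath K b ∈ H) : x ∈ H := by
  have hx : x = ∑ b ∈ Finsupp.support (M := K) x, coeff b x • ofPath K b := by
    refine (Finsupp.sum_single (M := K) x).symm.trans (Finset.sum_congr rfl fun b _ => ?_)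
    exact (Finsupp.smul_single_one b _).symm
  rw [hx]
  exact sum_mem fun b hb => h b (Finsupp.mem_support_iff.mp hb) _

theorem ofPath_mul_of_isComp {p q r : QuiverPath V} (h : IsComp p q r) :
    ofPath K p * ofPath K q = ofPath K r := by
  cases h
  rw [ofPath_mul_ofPath, pathMul_comp]

theorem ofPath_mul_of_ne {p q : QuiverPath V} (h : p.2.1 ≠ q.1) :
    ofPath K p * ofPath K q = 0 := by
  rw [ofPath_mul_ofPath, pathMul_of_ne K h]

theorem coeff_mul_ofPath {p q b : QuiverPath V} (h : IsComp p q b) (x : PathAlgebra K V) :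
    coeff b (x * ofPath K q) = coeff p x := by
  induction x using PathAlgebra.induction with
  | h0 => rw [zero_mul', map_zero, map_zero]
  | hadd x y hx hy => rw [right_distrib', map_add, map_add, hx, hy]
  | hsmul c r =>
    rw [smul_mul', map_smul, map_smul]
    congr 1
    by_cases hr : r.2.1 = q.1
    · obtain ⟨t, ht⟩ := IsComp.exists_comp hr
      rw [ofPath_mul_of_isComp ht]
      by_cases hrp : r = p
      · subst hrp
        rw [ht.eq h, coeff_ofPath_self, coeff_ofPath_self]
      · rw [coeff_ofPath_of_ne hrp, coeff_ofPath_of_ne]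
        rintro rfl
        exact hrp (ht.unique h rfl).1
    · rw [ofPath_mul_of_ne hr, map_zero, coeff_ofPath_of_ne]
      rintro rfl
      exact hr h.target_eq

theorem coeff_mul_ofPath_eq_zero {q b : QuiverPath V} (h : ∀ p, ¬ IsComp p q b)
    (x : PathAlgebra K V) : coeff b (x * ofPath K q) = 0 := by
  induction x using PathAlgebra.induction with
  | h0 => rw [zero_mul', map_zero]
  | hadd x y hx hy => rw [right_distrib', map_add, hx, hy, add_zero]
  | hsmul c r =>
    rw [smul_mul', map_smul]
    by_cases hr : r.2.1 = q.1
    · obtain ⟨t, ht⟩ := IsComp.exists_comp hr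
      rw [ofPath_mul_of_isComp ht, coeff_ofPath_of_ne, smul_zero]
      rintro rfl
      exact h _ ht
    · rw [ofPath_mul_of_ne hr, map_zero, smul_zero]

theorem ofPath_mem_homogeneous (p : QuiverPath V) : ofPath K p ∈ homogeneous K V p.length :=
  Submodule.subset_span ⟨p, rfl, rfl⟩

variable (K) in
/-- The subspace spanned by the paths that pass through a path of `S`. -/
def spanThrough (S : Set (QuiverPath V)) : Submodule K (PathAlgebra K V) :=
  Submodule.span K (ofPath K '' through S)

theorem ofPath_mem_spanThrough {S : Set (QuiverPath V)} {p : QuiverPath V} (h : p ∈ through S) :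
    ofPath K p ∈ spanThrough K S :=
  Submodule.subset_span ⟨p, h, rfl⟩

theorem mul_mem_spanThrough {S : Set (QuiverPath V)} (x : PathAlgebra K V) {y : PathAlgebra K V}
    (hy : y ∈ spanThrough K S) : x * y ∈ spanThrough K S ∧ y * x ∈ spanThrough K S := by
  induction hy using Submodule.span_induction with
  | zero => rw [zero_mul', mul_zero']; exact ⟨zero_mem _, zero_mem _⟩
  | add y z _ _ hy hz =>
    rw [left_distrib', right_distrib']
    exact ⟨add_mem hy.1 hz.1, add_mem hy.2 hz.2⟩
  | smul c y _ hy =>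
    rw [mul_smul', smul_mul']
    exact ⟨Submodule.smul_mem _ c hy.1, Submodule.smul_mem _ c hy.2⟩
  | mem y hy =>
    obtain ⟨q, hq, rfl⟩ := hy
    induction x using PathAlgebra.induction with
    | h0 => rw [zero_mul', mul_zero']; exact ⟨zero_mem _, zero_mem _⟩
    | hadd x z hx hz =>
      rw [left_distrib', right_distrib']
      exact ⟨add_mem hx.1 hz.1, add_mem hx.2 hz.2⟩
    | hsmul c p =>
      rw [mul_smul', smul_mul']
      refine ⟨Submodule.smul_mem _ c ?_, Submodule.smul_mem _ c ?_⟩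
      · by_cases h : p.2.1 = q.1
        · obtain ⟨r, hr⟩ := IsComp.exists_comp h
          rw [ofPath_mul_of_isComp hr]
          exact ofPath_mem_spanThrough (QuiverPath.through_of_right hr hq)
        · rw [ofPath_mul_of_ne h]; exact zero_mem _
      · by_cases h : q.2.1 = p.1
        · obtain ⟨r, hr⟩ := IsComp.exists_comp h
          rw [ofPath_mul_of_isComp hr]
          exact ofPath_mem_spanThrough (QuiverPath.through_of_left hr hq)
        · rw [ofPath_mul_of_ne h]; exact zero_mem _

/-- The span of the paths through `S` is already a two-sided ideal, so it contains the ideal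
generated by `S`. -/
theorem mem_monomialIdeal_iff [Fintype V] {S : Set (QuiverPath V)} {x : PathAlgebra K V} :
    x ∈ monomialIdeal K S ↔ ∀ b, b ∉ through S → coeff b x = 0 := by
  constructor
  · intro hx
    have h1 : x ∈ spanThrough K S := by
      have := TwoSidedIdeal.mem_span_iff.mp hx
        (TwoSidedIdeal.mk' (spanThrough K S : Set (PathAlgebra K V)) (zero_mem _) add_mem neg_mem
          (fun {x _} hy => (mul_mem_spanThrough x hy).1)
          (fun {_ y} hx => (mul_mem_spanThrough y hx).2)) ?_
      · rwa [TwoSidedIdeal.mem_mk'] at this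
      · rintro _ ⟨p, hp, rfl⟩
        rw [SetLike.mem_coe, TwoSidedIdeal.mem_mk']
        exact ofPath_mem_spanThrough (QuiverPath.through_of_mem hp)
    intro b hb
    have h2 : spanThrough K S ≤ LinearMap.ker (coeff b) := by
      refine Submodule.span_le.mpr ?_
      rintro _ ⟨p, hp, rfl⟩
      rw [SetLike.mem_coe, LinearMap.mem_ker, coeff_ofPath_of_ne]
      rintro rfl
      exact hb hp
    exact h2 h1
  · intro h
    refine mem_of_coeff (monomialIdeal K S).asIdeal.toAddSubgroup fun b hb c => ?_
    change c • ofPath K b ∈ monomialIdeal K S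
    obtain ⟨s, hs, u, t, w, h1, h2⟩ : b ∈ through S := by
      by_contra hb'
      exact hb (h b hb')
    rw [← ofPath_mul_of_isComp h2, ← ofPath_mul_of_isComp h1, ← smul_mul', ← smul_mul']
    refine TwoSidedIdeal.mul_mem_right _ _ _ (TwoSidedIdeal.mul_mem_left _ _ _ ?_)
    exact TwoSidedIdeal.subset_span ⟨s, hs, rfl⟩

end PathAlgebra

/-! ### Monomial algebras: coefficients, order filtration, annihilators of paths. -/

namespace QuiverAlgebra

open PathAlgebra

variable {K : Type u} {V : Type v} [Field K] [Fintype V] [Quiver.{w} V]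

theorem mk_surjective (I : TwoSidedIdeal (PathAlgebra K V)) : Function.Surjective (mk I) :=
  I.ringCon.mk'_surjective

theorem mk_eq_mk_iff {I : TwoSidedIdeal (PathAlgebra K V)} {x y : PathAlgebra K V} :
    mk I x = mk I y ↔ x - y ∈ I := by
  rw [← TwoSidedIdeal.rel_iff]
  exact RingCon.eq _

variable (K) in
/-- The algebra `KΓ/I` for the ideal `I` generated by a set of paths. -/
abbrev Monomial (S : Set (QuiverPath V)) : Type (max u v w) :=
  QuiverAlgebra (monomialIdeal K S)

variable (K) in
/-- The class of a path in `KΓ/I`. -/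
def pathClass (S : Set (QuiverPath V)) (p : QuiverPath V) : Monomial K S :=
  mk (monomialIdeal K S) (ofPath K p)

variable {S : Set (QuiverPath V)}

open Classical in
/-- The coefficient of a path outside the ideal in an element of a monomial algebra
(zero for the paths in the ideal). -/
def coef (b : QuiverPath V) : Monomial K S →+ K :=
  AddMonoidHom.mk'
    -- The chosen lift does not matter when `b ∉ through S`, as two lifts differ by an element of
    -- the ideal. The default `0` makes a nonzero coefficient imply `b ∉ through S`.
    (fun a => if b ∈ through S then 0 else coeff b (Function.surjInv (mk_surjective _) a)) <| by
    intro x y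
    split_ifs with h
    · rw [add_zero]
    · rw [← map_add, ← sub_eq_zero, ← map_sub]
      refine mem_monomialIdeal_iff.mp (mk_eq_mk_iff.mp ?_) b h
      simp only [map_add, Function.surjInv_eq]

theorem coef_mk {b : QuiverPath V} (hb : b ∉ through S) (x : PathAlgebra K V) :
    coef b (mk (monomialIdeal K S) x) = coeff b x := by
  refine (if_neg hb).trans ?_
  rw [← sub_eq_zero, ← map_sub]
  refine mem_monomialIdeal_iff.mp (mk_eq_mk_iff.mp ?_) b hb
  exact Function.surjInv_eq (mk_surjective _) _

theorem coef_eq_zero_of_through {b : QuiverPath V} (hb : b ∈ through S) (a : Monomial K S) :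
    coef b a = 0 :=
  if_pos hb

theorem notMem_through_of_coef {b : QuiverPath V} {a : Monomial K S} (h : coef b a ≠ 0) :
    b ∉ through S :=
  fun hb => h (coef_eq_zero_of_through hb a)

theorem mem_of_coef {a : Monomial K S} (H : AddSubgroup (Monomial K S))
    (h : ∀ b, coef b a ≠ 0 → ∀ c : K, mk (monomialIdeal K S) (c • ofPath K b) ∈ H) : a ∈ H := by
  obtain ⟨x, rfl⟩ := mk_surjective _ a
  suffices hx : x ∈ H.comap (mk (monomialIdeal K S)).toAddMonoidHom from hx
  refine mem_of_coeff _ fun b hb c => ?_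
  by_cases hbS : b ∈ through S
  · have h0 : mk (monomialIdeal K S) (c • ofPath K b) = mk _ 0 := by
      rw [mk_eq_mk_iff, sub_zero]
      refine mem_monomialIdeal_iff.mpr fun b' hb' => ?_
      rw [map_smul, coeff_ofPath_of_ne, smul_zero]
      rintro rfl
      exact hb' hbS
    change mk (monomialIdeal K S) (c • ofPath K b) ∈ H
    rw [h0, map_zero]
    exact zero_mem _
  · exact h b (by rwa [coef_mk hbS]) c

theorem eq_zero_of_coef {a : Monomial K S} (h : ∀ b, coef b a = 0) : a = 0 :=
  AddSubgroup.mem_bot.mp (mem_of_coef ⊥ fun b hb => absurd (h b) hb)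

theorem coef_mul_pathClass {p q b : QuiverPath V} (h : IsComp p q b) (hb : b ∉ through S)
    (a : Monomial K S) : coef b (a * pathClass K S q) = coef p a := by
  obtain ⟨x, rfl⟩ := mk_surjective _ a
  have hp : p ∉ through S := fun hp => hb (QuiverPath.through_of_left h hp)
  rw [pathClass, ← map_mul, coef_mk hb, coef_mk hp, coeff_mul_ofPath h]

theorem coef_mul_pathClass_eq_zero {q b : QuiverPath V} (h : ∀ p, ¬ IsComp p q b)
    (a : Monomial K S) : coef b (a * pathClass K S q) = 0 := by
  by_cases hb : b ∈ through S
  · exact coef_eq_zero_of_through hb _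
  obtain ⟨x, rfl⟩ := mk_surjective _ a
  rw [pathClass, ← map_mul, coef_mk hb, coeff_mul_ofPath_eq_zero h]

theorem exists_isComp_of_coef_ne_zero {q b : QuiverPath V} {a : Monomial K S}
    (h : coef b (a * pathClass K S q) ≠ 0) : ∃ p, IsComp p q b ∧ coef p a ≠ 0 := by
  by_contra! hn
  by_cases hp : ∃ p, IsComp p q b
  · obtain ⟨p, hp⟩ := hp
    exact h ((coef_mul_pathClass hp (notMem_through_of_coef h) a).trans (hn p hp))
  · exact h (coef_mul_pathClass_eq_zero (not_exists.mp hp) a)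

theorem coef_pathClass_self {b : QuiverPath V} (hb : b ∉ through S) :
    coef b (pathClass K S b) = 1 := by
  rw [pathClass, coef_mk hb, coeff_ofPath_self]

theorem coef_mk_smul_eq_zero {b p : QuiverPath V} (h : p ≠ b) (c : K) :
    coef b (mk (monomialIdeal K S) (c • ofPath K p)) = 0 := by
  by_cases hb : b ∈ through S
  · exact coef_eq_zero_of_through hb _
  · rw [coef_mk hb, map_smul, coeff_ofPath_of_ne h, smul_zero]

theorem coef_pathClass_of_ne {b p : QuiverPath V} (h : p ≠ b) :
    coef b (pathClass K S p) = 0 := by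
  simpa only [one_smul] using! coef_mk_smul_eq_zero (S := S) h (1 : K)

theorem pathClass_mul_of_isComp {p q r : QuiverPath V} (h : IsComp p q r) :
    pathClass K S p * pathClass K S q = pathClass K S r := by
  rw [pathClass, pathClass, ← map_mul, ofPath_mul_of_isComp h, pathClass]

theorem mk_smul_mul_pathClass {p q r : QuiverPath V} (h : IsComp p q r) (c : K) :
    mk (monomialIdeal K S) (c • ofPath K p) * pathClass K S q =
      mk (monomialIdeal K S) (c • ofPath K r) := by
  rw [pathClass, ← map_mul, PathAlgebra.smul_mul', ofPath_mul_of_isComp h]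

/-- A path times the vertex in which it ends. -/
theorem mul_vertex_self (p : QuiverPath V) :
    pathClass K S p * pathClass K S (vertex p.2.1) = pathClass K S p :=
  pathClass_mul_of_isComp (IsComp.vertex_right p)

theorem vertex_mul_vertex (a : V) :
    pathClass K S (vertex a) * pathClass K S (vertex a) = pathClass K S (vertex a) :=
  mul_vertex_self (vertex a)

theorem coef_mul_vertex_of_target {b : QuiverPath V} {x : V} (h : b.2.1 = x) (a : Monomial K S) :
    coef b (a * pathClass K S (vertex x)) = coef b a := by
  subst h
  by_cases hb : b ∈ through S
  · rw [coef_eq_zero_of_through hb, coef_eq_zero_of_through hb]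
  · exact coef_mul_pathClass (IsComp.vertex_right b) hb a

theorem target_of_coef_mul_vertex {b : QuiverPath V} {x : V} {a : Monomial K S}
    (h : coef b (a * pathClass K S (vertex x)) ≠ 0) : b.2.1 = x := by
  obtain ⟨p, hp, -⟩ := exists_isComp_of_coef_ne_zero h
  exact hp.target

theorem mul_vertex_eq_zero_iff {x : V} {a : Monomial K S} :
    a * pathClass K S (vertex x) = 0 ↔ ∀ b : QuiverPath V, b.2.1 = x → coef b a = 0 := by
  refine ⟨fun h b hb => ?_, fun h => eq_zero_of_coef fun b => ?_⟩
  · rw [← coef_mul_vertex_of_target hb, h, map_zero]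
  · by_contra hb
    have ht := target_of_coef_mul_vertex hb
    rw [coef_mul_vertex_of_target ht] at hb
    exact hb (h b ht)

variable (K S) in
/-- The elements of order at least `n`, that is, without paths of length less than `n`. -/
def order (n : ℕ) : AddSubgroup (Monomial K S) where
  carrier := {a | ∀ b : QuiverPath V, b.length < n → coef b a = 0}
  zero_mem' _ _ := map_zero _
  add_mem' hx hy b hb := by rw [map_add, hx b hb, hy b hb, add_zero]
  neg_mem' hx b hb := by rw [map_neg, hx b hb, neg_zero]

theorem mem_order_zero (a : Monomial K S) : a ∈ order K S 0 := fun _ hb => absurd hb (by omega)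

/-- Replaces nilpotency of the arrow ideal: vanishing is shown by raising the order step by step. -/
theorem eq_zero_of_mem_order {a : Monomial K S} (h : ∀ n, a ∈ order K S n) : a = 0 :=
  eq_zero_of_coef fun b => h (b.length + 1) b (Nat.lt_succ_self _)

theorem le_length_of_coef {n : ℕ} {a : Monomial K S} (ha : a ∈ order K S n) {b : QuiverPath V}
    (h : coef b a ≠ 0) : n ≤ b.length := by
  by_contra! hb
  exact h (ha b hb)

theorem mk_smul_ofPath_mem_order {n : ℕ} {p : QuiverPath V} (hp : n ≤ p.length) (c : K) :
    mk (monomialIdeal K S) (c • ofPath K p) ∈ order K S n := fun b hb =>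
  coef_mk_smul_eq_zero (by rintro rfl; omega) c

theorem mul_mem_order {m n : ℕ} {a b : Monomial K S} (ha : a ∈ order K S m)
    (hb : b ∈ order K S n) : a * b ∈ order K S (m + n) := by
  suffices h : a ∈ (order K S (m + n)).comap (AddMonoidHom.mulRight b) from h
  refine mem_of_coef _ fun p hp c => ?_
  change mk (monomialIdeal K S) (c • ofPath K p) * b ∈ order K S (m + n)
  suffices h : b ∈ (order K S (m + n)).comap
      (AddMonoidHom.mulLeft (mk (monomialIdeal K S) (c • ofPath K p))) from h
  refine mem_of_coef _ fun q hq c' => ?_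
  change mk (monomialIdeal K S) (c • ofPath K p) * mk (monomialIdeal K S) (c' • ofPath K q) ∈ order K S (m + n)
  have h1 := le_length_of_coef ha hp
  have h2 := le_length_of_coef hb hq
  rw [← map_mul, PathAlgebra.smul_mul', PathAlgebra.mul_smul', smul_smul]
  by_cases h : p.2.1 = q.1
  · obtain ⟨r, hr⟩ := IsComp.exists_comp h
    rw [ofPath_mul_of_isComp hr]
    exact mk_smul_ofPath_mem_order (by rw [hr.length]; omega) _
  · rw [ofPath_mul_of_ne h, smul_zero, map_zero]
    exact zero_mem _

theorem mem_arrowIdeal_iff {a : Monomial K S} :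
    a ∈ arrowIdeal (monomialIdeal K S) ↔ a ∈ order K S 1 := by
  constructor
  · intro ha
    have := TwoSidedIdeal.mem_span_iff.mp (TwoSidedIdeal.mem_asIdeal.mp ha)
      (TwoSidedIdeal.mk' (order K S 1 : Set (Monomial K S)) (zero_mem _) add_mem neg_mem
        (fun {x _} hy => by
          simpa only [zero_add] using! mul_mem_order (mem_order_zero x) hy)
        (fun {_ y} hx => mul_mem_order hx (mem_order_zero y))) ?_
    · rwa [TwoSidedIdeal.mem_mk'] at this
    · rintro _ ⟨p, hp, rfl⟩
      rw [SetLike.mem_coe, TwoSidedIdeal.mem_mk']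
      simpa only [one_smul] using! mk_smul_ofPath_mem_order (S := S) hp.ge (1 : K)
  · intro ha
    refine mem_of_coef (arrowIdeal (monomialIdeal K S)).toAddSubgroup fun b hb c => ?_
    obtain ⟨p, q, h, hq⟩ := IsComp.exists_suffix b (le_length_of_coef ha hb)
    rw [← mk_smul_mul_pathClass h]
    exact Ideal.mul_mem_left _ _ (TwoSidedIdeal.subset_span ⟨q, hq, rfl⟩)

variable (K) in
/-- The elements `a` all of whose paths that end in the origin of `p` have their end in
`next S p`. For a path `p` of positive length this is the left annihilator of `p`. -/
def annihilator (S : Set (QuiverPath V)) (p : QuiverPath V) : Set (Monomial K S) :=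
  {a | ∀ b : QuiverPath V, b.2.1 = p.1 → coef b a ≠ 0 → ∃ q ∈ next S p, ∃ t, IsComp t q b}

/-- Right multiplication by `p` is injective on the paths ending at the origin of `p`, so no terms
cancel and each path of `a` can be tested alone. -/
theorem mul_pathClass_eq_zero_iff {p : QuiverPath V} (hp : p.length ≠ 0) {a : Monomial K S} :
    a * pathClass K S p = 0 ↔ a ∈ annihilator K S p := by
  refine ⟨fun h b hb hba => ?_, fun h => eq_zero_of_coef fun r => ?_⟩
  · obtain ⟨r, hr⟩ := IsComp.exists_comp hb
    refine QuiverPath.exists_next_suffix hp (notMem_through_of_coef hba) hr ?_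
    by_contra hrS
    rw [← coef_mul_pathClass hr hrS, h, map_zero] at hba
    exact hba rfl
  · by_contra hr
    obtain ⟨b, hb, hba⟩ := exists_isComp_of_coef_ne_zero hr
    obtain ⟨q, ⟨-, ⟨h0, -⟩ | ⟨-, -, ⟨c, hc, hqc⟩, -⟩⟩, t, ht⟩ := h b hb.target_eq hba
    · exact hp h0
    obtain ⟨z, hz, hz'⟩ := ht.assoc_right hb
    rw [hz.eq hqc] at hz'
    exact notMem_through_of_coef hr (QuiverPath.through_of_right hz' hc)

/-- For a vertex, `annihilator` describes the relations of its class in `Λ₀`, not in `Λ`. With this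
convention the start of the resolution has the same form as the later steps. -/
theorem mem_annihilator_of_length_zero {p : QuiverPath V} (hp : p.length = 0)
    {a : Monomial K S} :
    a ∈ annihilator K S p ↔ a * pathClass K S p ∈ order K S 1 := by
  have hpv := QuiverPath.eq_vertex hp
  generalize p.2.1 = x at hpv
  subst hpv
  refine ⟨fun h b hb => ?_, fun h b hb hba => ?_⟩
  · by_contra hba
    have ht := target_of_coef_mul_vertex hba
    rw [coef_mul_vertex_of_target ht] at hba
    obtain ⟨q, ⟨-, ⟨-, h1⟩ | ⟨h0, -⟩⟩, t, htq⟩ := h b ht hba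
    · have := htq.length
      omega
    · exact h0 rfl
  · rw [← coef_mul_vertex_of_target hb] at hba
    obtain ⟨t, q, htq, hq⟩ := IsComp.exists_suffix b (le_length_of_coef h hba)
    exact ⟨q, ⟨htq.target.symm.trans hb, Or.inl ⟨rfl, hq⟩⟩, t, htq⟩

theorem pathClass_mem_annihilator {p q : QuiverPath V} (hq : q ∈ next S p) :
    pathClass K S q ∈ annihilator K S p := by
  intro b _ hb
  by_cases h : q = b
  · subst h
    exact ⟨q, hq, _, IsComp.vertex_left q⟩
  · exact absurd (coef_pathClass_of_ne h) hb

theorem mul_vertex_mem_span {p : QuiverPath V} {a : Monomial K S}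
    (ha : a ∈ annihilator K S p) :
    a * pathClass K S (vertex p.1) ∈ Ideal.span (pathClass K S '' next S p) := by
  refine mem_of_coef (Ideal.span (pathClass K S '' next S p)).toAddSubgroup fun b hb c => ?_
  have ht := target_of_coef_mul_vertex hb
  rw [coef_mul_vertex_of_target ht] at hb
  obtain ⟨q, hq, t, htq⟩ := ha b ht hb
  rw [← mk_smul_mul_pathClass htq]
  exact Ideal.mul_mem_left _ _ (Ideal.subset_span ⟨q, hq, rfl⟩)

theorem mul_vertex_mem_order {p : QuiverPath V} (hp : p ∉ through S) {a : Monomial K S}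
    (ha : a ∈ annihilator K S p) : a * pathClass K S (vertex p.1) ∈ order K S 1 := by
  intro b hb
  by_contra hba
  have ht := target_of_coef_mul_vertex hba
  rw [coef_mul_vertex_of_target ht] at hba
  obtain ⟨q, hq, t, htq⟩ := ha b ht hba
  have h1 := QuiverPath.length_pos_of_mem_next hp hq
  have h2 := htq.length
  omega

theorem vertex_notMem_order (hS : ∀ p ∈ S, 2 ≤ p.length) (x : V) :
    pathClass K S (vertex x) ∉ order K S 1 := by
  intro h
  have h1 : vertex x ∉ through S := fun hx => by
    have := QuiverPath.two_le_length hS hx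
    rw [QuiverPath.length_vertex] at this
    omega
  have h2 := h (vertex x) Nat.one_pos
  rw [coef_pathClass_self h1] at h2
  exact one_ne_zero h2

end QuiverAlgebra

end

noncomputable section

open QuiverPath (IsComp through next vertex GradedFamily)

/-! ### Graded modules: Nakayama, minimal covers and free families. -/

namespace QuiverAlgebra

open PathAlgebra

variable {K : Type u} {V : Type v} [Field K] [Fintype V] [Quiver.{w} V] {S : Set (QuiverPath V)}

section Internal

variable {P : Type*} [AddCommGroup P] {C : ℤ → AddSubgroup P}

theorem exists_projection (hC : DirectSum.IsInternal C) (j : ℤ) :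
    ∃ f : P →+ P, (∀ m, f m ∈ C j) ∧ (∀ m ∈ C j, f m = m) ∧
      ∀ k, k ≠ j → ∀ m ∈ C k, f m = 0 := by
  classical
  let := hC.chooseDecomposition
  refine ⟨AddMonoidHom.mk' (fun m => (DirectSum.decompose C m j : P)) fun a b => ?_,
    fun m => SetLike.coe_mem _, fun m hm => DirectSum.decompose_of_mem_same C hm,
    fun k hk m hm => DirectSum.decompose_of_mem_ne C hm hk⟩
  rw [DirectSum.decompose_add]
  rfl

theorem eq_top_of_component_le (hC : DirectSum.IsInternal C) {H : AddSubgroup P}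
    (h : ∀ j, C j ≤ H) (p : P) : p ∈ H := by
  classical
  let := hC.chooseDecomposition
  induction p using DirectSum.Decomposition.inductionOn C with
  | zero => exact zero_mem _
  | homogeneous m => exact h _ m.2
  | add a b ha hb => exact add_mem ha hb

/-- Project onto degree `j`: the generators of other degrees vanish and those of degree `j` stay
fixed. -/
theorem mem_closure_of_mem_component (hC : DirectSum.IsInternal C) {T : ℤ → Set P}
    (hT : ∀ k, T k ⊆ C k) {j : ℤ} {p : P} (hp : p ∈ C j)
    (h : p ∈ AddSubgroup.closure (⋃ k, T k)) : p ∈ AddSubgroup.closure (T j) := by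
  obtain ⟨f, -, hf, hf0⟩ := exists_projection hC j
  rw [← hf p hp]
  suffices h : p ∈ (AddSubgroup.closure (T j)).comap f from h
  refine (AddSubgroup.closure_le _).mpr (fun t ht => ?_) h
  obtain ⟨k, hk⟩ := Set.mem_iUnion.mp ht
  change f t ∈ AddSubgroup.closure (T j)
  by_cases hkj : k = j
  · subst hkj
    rw [hf t (hT k hk)]
    exact AddSubgroup.subset_closure hk
  · rw [hf0 k hkj t (hT k hk)]
    exact zero_mem _

end Internal

variable {P N : Type*} [AddCommGroup P] [Module (Monomial K S) P] [AddCommGroup N]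
  [Module (Monomial K S) N]

/-- A grading of a module that is compatible with the length grading. -/
structure IsGrading (C : ℤ → AddSubgroup P) : Prop where
  isInternal : DirectSum.IsInternal C
  smul_mem : ∀ (i : ℕ) (j : ℤ), ∀ x ∈ homogeneous K V i, ∀ m ∈ C j,
    mk (monomialIdeal K S) x • m ∈ C (i + j)

variable (K S P) in
/-- The submodule `JP`. -/
def radical : Submodule (Monomial K S) P :=
  arrowIdeal (monomialIdeal K S) • (⊤ : Submodule (Monomial K S) P)

theorem smul_mem_radical {a : Monomial K S} (ha : a ∈ order K S 1) (p : P) :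
    a • p ∈ radical K S P :=
  Submodule.smul_mem_smul (mem_arrowIdeal_iff.mpr ha) Submodule.mem_top

theorem radical_le {H : AddSubgroup P}
    (h : ∀ a ∈ order K S 1, ∀ p : P, a • p ∈ H) {p : P} (hp : p ∈ radical K S P) : p ∈ H :=
  Submodule.smul_induction_on hp (fun a ha p _ => h a (mem_arrowIdeal_iff.mp ha) p)
    fun _ _ => add_mem

theorem smul_mem_of_coef {a : Monomial K S} {p : P} {H : AddSubgroup P}
    (h : ∀ b, coef b a ≠ 0 → ∀ c : K, mk (monomialIdeal K S) (c • ofPath K b) • p ∈ H) :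
    a • p ∈ H := by
  suffices ha : a ∈ H.comap ((smulAddHom (Monomial K S) P).flip p) from ha
  exact mem_of_coef _ h

namespace IsGrading

variable {C : ℤ → AddSubgroup P}

theorem smul_path_mem (hC : IsGrading (K := K) (S := S) C) (b : QuiverPath V) (c : K) {j : ℤ}
    {m : P} (hm : m ∈ C j) :
    QuiverAlgebra.mk (monomialIdeal K S) (c • ofPath K b) • m ∈ C (b.length + j) :=
  hC.smul_mem _ _ _ (Submodule.smul_mem _ c (ofPath_mem_homogeneous b)) _ hm

/-- The products of scalar multiples of paths of length at least `n` with homogeneous elements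
whose degrees lie in `D`, of total degree `k`. -/
def pathMultiples (K : Type u) [Field K] (S : Set (QuiverPath V)) {P : Type*} [AddCommGroup P]
    [Module (Monomial K S) P] (C : ℤ → AddSubgroup P) (n : ℕ) (D : Set ℤ) (k : ℤ) : Set P :=
  {m | ∃ (b : QuiverPath V) (c : K) (j : ℤ) (p : P), n ≤ b.length ∧ j ∈ D ∧ p ∈ C j ∧
    b.length + j = k ∧ m = QuiverAlgebra.mk (monomialIdeal K S) (c • ofPath K b) • p}

theorem pathMultiples_subset (hC : IsGrading (K := K) (S := S) C) (n : ℕ) (D : Set ℤ) (k : ℤ) :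
    pathMultiples K S C n D k ⊆ C k := by
  rintro _ ⟨b, c, j, p, -, -, hp, rfl, rfl⟩
  exact hC.smul_path_mem b c hp

theorem smul_mem_closure {n : ℕ} {a : Monomial K S} (ha : a ∈ order K S n)
    {D : Set ℤ} {j : ℤ} (hj : j ∈ D) {p : P} (hp : p ∈ C j) :
    a • p ∈ AddSubgroup.closure (⋃ k, pathMultiples K S C n D k) :=
  smul_mem_of_coef fun b hb c => AddSubgroup.subset_closure <| Set.mem_iUnion.mpr
    ⟨_, b, c, j, p, le_length_of_coef ha hb, hj, hp, rfl, rfl⟩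

theorem radical_le_closure (hC : IsGrading (K := K) (S := S) C) {p : P}
    (h : p ∈ radical K S P) :
    p ∈ AddSubgroup.closure (⋃ k, pathMultiples K S C 1 Set.univ k) := by
  refine radical_le (fun a ha p => ?_) h
  suffices hp : p ∈ (AddSubgroup.closure (⋃ k, pathMultiples K S C 1 Set.univ k)).comap
      (smulAddHom (Monomial K S) P a) from hp
  exact eq_top_of_component_le hC.isInternal
    (fun j p hp => smul_mem_closure ha (Set.mem_univ j) hp) p

/-- If a graded projective module agrees with its radical in negative degrees, then it vanishes
there. -/
theorem eq_zero_of_neg [Module.Projective (Monomial K S) P]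
    (hC : IsGrading (K := K) (S := S) C)
    (hneg : ∀ j < 0, ∀ p ∈ C j, p ∈ radical K S P) {j : ℤ} (hj : j < 0) {p : P} (hp : p ∈ C j) :
    p = 0 := by
  -- An element of negative degree in the radical is a sum of positive-length paths times elements
  -- of still lower degree, so each pass raises the order of its image under any linear form by one.
  -- Projectivity then embeds `P` into a free module, where all coordinates of `p` vanish.
  have key : ∀ n : ℕ, ∀ f : P →ₗ[Monomial K S] Monomial K S, ∀ j < 0, ∀ p ∈ C j,
      f p ∈ order K S n := by
    intro n f
    induction n with
    | zero => exact fun _ _ _ _ => mem_order_zero _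
    | succ n ih =>
      intro j hj p hp
      suffices h : p ∈ (order K S (n + 1)).comap f.toAddMonoidHom from h
      refine (AddSubgroup.closure_le _).mpr ?_ (mem_closure_of_mem_component hC.isInternal
        (hC.pathMultiples_subset 1 Set.univ) hp (hC.radical_le_closure (hneg j hj p hp)))
      rintro _ ⟨b, c, i, m, hb, -, hm, rfl, rfl⟩
      change f _ ∈ order K S (n + 1)
      rw [map_smul, smul_eq_mul, add_comm]
      exact mul_mem_order (mk_smul_ofPath_mem_order hb c) (ih i (by omega) m hm)
  obtain ⟨s, hs⟩ := Module.projective_def.mp ‹Module.Projective (Monomial K S) P›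
  rw [← hs p]
  have : s p = 0 := by
    refine Finsupp.ext fun q => ?_
    exact eq_zero_of_mem_order fun n => key n ((Finsupp.lapply q).comp s) j hj p hp
  rw [this, map_zero]

/-- The graded Nakayama lemma. -/
theorem span_eq_top (hC : IsGrading (K := K) (S := S) C) (hneg : ∀ j < 0, ∀ p ∈ C j, p = 0)
    {ι : Type*} {y : ι → P} {g : ι → ℤ} (hy : ∀ i, y i ∈ C (g i))
    (h : ∀ p : P, ∃ q ∈ Submodule.span (Monomial K S) (Set.range y), p - q ∈ radical K S P) :
    Submodule.span (Monomial K S) (Set.range y) = ⊤ := by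
  set M := Submodule.span (Monomial K S) (Set.range y) with hM
  -- `M` has homogeneous generators, hence is additively generated by its homogeneous elements.
  have hcl : ∀ q ∈ M, q ∈ AddSubgroup.closure (⋃ k, {m : P | m ∈ C k ∧ m ∈ M}) := by
    intro q hq
    induction hq using Submodule.span_induction with
    | zero => exact zero_mem _
    | add _ _ _ _ h1 h2 => exact add_mem h1 h2
    | mem q hq =>
      obtain ⟨i, rfl⟩ := hq
      exact AddSubgroup.subset_closure
        (Set.mem_iUnion_of_mem (g i) ⟨hy i, Submodule.subset_span (Set.mem_range_self i)⟩)
    | smul a q _ hq =>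
      suffices h : q ∈ (AddSubgroup.closure (⋃ k, {m : P | m ∈ C k ∧ m ∈ M})).comap
        (smulAddHom (Monomial K S) P a) from h
      refine (AddSubgroup.closure_le _).mpr (fun m hm => ?_) hq
      obtain ⟨k, hk, hmM⟩ := Set.mem_iUnion.mp hm
      change a • m ∈ AddSubgroup.closure (⋃ k, {m : P | m ∈ C k ∧ m ∈ M})
      exact smul_mem_of_coef fun b _ c => AddSubgroup.subset_closure <|
        Set.mem_iUnion.mpr ⟨_, hC.smul_path_mem b c hk, M.smul_mem _ hmM⟩
  -- Induction on the degree, starting from the vanishing in negative degrees: the radical part of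
  -- `p` comes from elements of smaller degree.
  have key : ∀ n : ℕ, ∀ j < (n : ℤ), ∀ p ∈ C j, p ∈ M := by
    intro n
    induction n with
    | zero => exact fun j hj p hp => hneg j hj p hp ▸ zero_mem _
    | succ n ih =>
      intro j hj p hp
      obtain ⟨q, hq, hr⟩ := h p
      have h1 : p ∈ AddSubgroup.closure
          (⋃ k, ({m : P | m ∈ C k ∧ m ∈ M} ∪ pathMultiples K S C 1 Set.univ k)) := by
        rw [← add_sub_cancel q p]
        refine add_mem (AddSubgroup.closure_mono ?_ (hcl q hq))
          (AddSubgroup.closure_mono ?_ (hC.radical_le_closure hr))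
        · exact Set.iUnion_mono fun k => Set.subset_union_left
        · exact Set.iUnion_mono fun k => Set.subset_union_right
      have h2 := mem_closure_of_mem_component hC.isInternal
        (fun k => Set.union_subset (fun m hm => hm.1) (hC.pathMultiples_subset 1 Set.univ k)) hp h1
      refine (AddSubgroup.closure_le M.toAddSubgroup).mpr ?_ h2
      rintro m (⟨-, hm⟩ | ⟨b, c, i, m, hb, -, hm, rfl, rfl⟩)
      · exact hm
      · exact M.smul_mem _ (ih i (by push_cast at hj; omega) m hm)
  refine eq_top_iff.mpr fun p _ => eq_top_of_component_le (H := M.toAddSubgroup) hC.isInternal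
    (fun j p hp => key (j.toNat + 1) j (by omega) p hp) p

end IsGrading

/-- `y` is a homogeneous generating family of a graded module that makes it the direct sum of
the indecomposable projective modules given by the origins of the paths of `F`. -/
structure IsFreeFamily (C : ℤ → AddSubgroup P) (F : GradedFamily V) (y : F.ι → P) : Prop where
  mem : ∀ c, y c ∈ C (F.deg c)
  vertex_smul : ∀ c, pathClass K S (vertex (F.path c).1) • y c = y c
  span_eq_top : Submodule.span (Monomial K S) (Set.range y) = ⊤
  indep : ∀ f : F.ι →₀ Monomial K S, Finsupp.linearCombination (Monomial K S) y f = 0 →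
    ∀ c, f c * pathClass K S (vertex (F.path c).1) = 0

/-- `π` maps a graded module onto the submodule generated by the family `x`, whose relations
are the elements of the annihilators of the paths of `F`, with kernel in the radical. -/
structure IsMinimalCover (C : ℤ → AddSubgroup P) (π : P →ₗ[Monomial K S] N)
    (F : GradedFamily V) (x : F.ι → N) : Prop where
  ker_le : LinearMap.ker π ≤ radical K S P
  range_eq : LinearMap.range π = Submodule.span (Monomial K S) (Set.range x)
  relations : ∀ f : F.ι →₀ Monomial K S, Finsupp.linearCombination (Monomial K S) x f = 0 ↔
    ∀ c, f c ∈ annihilator K S (F.path c)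
  exists_lift : ∀ c, ∃ p ∈ C (F.deg c), π p = x c
  map_neg : ∀ j < 0, ∀ p ∈ C j, π p = 0

variable {C : ℤ → AddSubgroup P} {F : GradedFamily V}

namespace IsMinimalCover

variable {π : P →ₗ[Monomial K S] N} {x : F.ι → N}

theorem smul_eq_zero (h : IsMinimalCover C π F x) {c : F.ι} {a : Monomial K S}
    (ha : a ∈ annihilator K S (F.path c)) : a • x c = 0 := by
  classical
  rw [← Finsupp.linearCombination_single]
  refine (h.relations _).mpr fun c' => ?_
  rw [Finsupp.single_apply]
  split_ifs with hc
  · exact hc ▸ ha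
  · intro b _ hb
    exact absurd (map_zero _) hb

theorem vertex_smul (h : IsMinimalCover C π F x) (c : F.ι) :
    pathClass K S (vertex (F.path c).1) • x c = x c := by
  have h1 : (pathClass K S (vertex (F.path c).1) - 1) • x c = 0 := by
    refine h.smul_eq_zero fun b hb hne => absurd (mul_vertex_eq_zero_iff.mp ?_ b hb) hne
    rw [sub_mul, one_mul, vertex_mul_vertex, sub_self]
  rwa [sub_smul, one_smul, sub_eq_zero] at h1

theorem eq_zero_of_neg [Module.Projective (Monomial K S) P] (h : IsMinimalCover C π F x)
    (hC : IsGrading (K := K) (S := S) C) {j : ℤ} (hj : j < 0) {p : P} (hp : p ∈ C j) : p = 0 :=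
  hC.eq_zero_of_neg (fun j hj p hp => h.ker_le (h.map_neg j hj p hp)) hj hp

/-- Lift `π` to a map `ψ` into the free module on the index set. Then `ψ (y c)` differs from the
basis vector at `c` by a relation, which has positive order at the vertices. Applying `ψ` to a
relation among the `y c` shows that its coefficients, cut down by the vertices, have order `n + 1`
whenever they have order `n`. Only the products with the vertices can vanish, as `y c` generates a
copy of `Λe` and not of `Λ`. -/
theorem indep [Module.Projective (Monomial K S) P] (h : IsMinimalCover C π F x)
    (hF : ∀ c, F.path c ∉ through S) {y : F.ι → P} (hy : ∀ c, π (y c) = x c)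
    (hv : ∀ c, pathClass K S (vertex (F.path c).1) • y c = y c) (f : F.ι →₀ Monomial K S)
    (hf : Finsupp.linearCombination (Monomial K S) y f = 0) (c : F.ι) :
    f c * pathClass K S (vertex (F.path c).1) = 0 := by
  classical
  obtain ⟨ψ, hψ⟩ : ∃ ψ : P →ₗ[Monomial K S] (F.ι →₀ Monomial K S),
      ∀ p, Finsupp.linearCombination (Monomial K S) x (ψ p) = π p := by
    have hmem : ∀ v, Finsupp.linearCombination (Monomial K S) x v ∈ LinearMap.range π := fun v => by
      rw [h.range_eq, ← Finsupp.range_linearCombination]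
      exact ⟨v, rfl⟩
    obtain ⟨ψ, hψ⟩ := Module.projective_lifting_property
      ((Finsupp.linearCombination (Monomial K S) x).codRestrict (LinearMap.range π) hmem)
      π.rangeRestrict (by
        rintro ⟨z, hz⟩
        rw [h.range_eq, ← Finsupp.range_linearCombination] at hz
        obtain ⟨v, hv⟩ := hz
        exact ⟨v, Subtype.ext hv⟩)
    exact ⟨ψ, fun p => congrArg Subtype.val (LinearMap.congr_fun hψ p)⟩
  set e : F.ι → Monomial K S := fun c => pathClass K S (vertex (F.path c).1) with he
  have hdiff : ∀ c c', (ψ (y c) - Finsupp.single c 1 : F.ι →₀ Monomial K S) c' * e c' ∈ order K S 1 := by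
    refine fun c c' => mul_vertex_mem_order (hF c') ((h.relations _).mp ?_ c')
    rw [map_sub, hψ, hy, Finsupp.linearCombination_single, one_smul, sub_self]
  have hsum : ∑ c ∈ f.support, (f c * e c) • y c = 0 := by
    refine Eq.trans (Finset.sum_congr rfl fun c _ => ?_) hf
    rw [mul_smul, hv]
    rfl
  have key : ∀ n, ∀ c ∈ f.support, f c * e c ∈ order K S n := by
    intro n
    induction n with
    | zero => exact fun _ _ => mem_order_zero _
    | succ n ih =>
      intro c' hc'
      have h1 : ∑ c ∈ f.support, f c * e c * (ψ (y c) c' * e c') = 0 := by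
        have := congrArg (fun v : F.ι →₀ Monomial K S => v c' * e c') (congrArg ψ hsum)
        simpa only [map_sum, map_smul, map_zero, Finsupp.finsetSum_apply, Finsupp.smul_apply,
          smul_eq_mul, Finset.sum_mul, Finsupp.zero_apply, zero_mul, mul_assoc] using this
      have h2 : ∑ c ∈ f.support, f c * e c * ((ψ (y c) - Finsupp.single c 1 : F.ι →₀ Monomial K S) c' * e c')
          = - (f c' * e c') := by
        simp only [Finsupp.sub_apply, sub_mul, mul_sub, Finset.sum_sub_distrib, h1, zero_sub]
        rw [Finset.sum_eq_single c']
        · rw [Finsupp.single_eq_same, one_mul, mul_assoc, vertex_mul_vertex]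
        · intro c _ hc
          rw [Finsupp.single_eq_of_ne hc.symm, zero_mul, mul_zero]
        · exact fun hn => absurd hc' hn
      rw [← neg_mem_iff, ← h2]
      exact sum_mem fun c hc => mul_mem_order (ih c hc) (hdiff c c')
  by_cases hc : c ∈ f.support
  · exact eq_zero_of_mem_order fun n => key n c hc
  · rw [Finsupp.notMem_support_iff.mp hc, zero_mul]

theorem exists_isFreeFamily [Module.Projective (Monomial K S) P] (h : IsMinimalCover C π F x)
    (hC : IsGrading (K := K) (S := S) C) (hF : ∀ c, F.path c ∉ through S) :
    ∃ y : F.ι → P, IsFreeFamily (K := K) (S := S) C F y ∧ ∀ c, π (y c) = x c := by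
  choose z hz hπ using h.exists_lift
  -- The vertex is an idempotent of degree `0` that fixes `x c`, so this changes neither the degree
  -- nor the image of the lift.
  let y : F.ι → P := fun c => pathClass K S (vertex (F.path c).1) • z c
  have hπy : ∀ c, π (y c) = x c := fun c => by rw [map_smul, hπ, h.vertex_smul]
  have hv : ∀ c, pathClass K S (vertex (F.path c).1) • y c = y c := fun c => by
    rw [← mul_smul, vertex_mul_vertex]
  have hy : ∀ c, y c ∈ C (F.deg c) := fun c => by
    have := hC.smul_mem 0 _ _ (ofPath_mem_homogeneous (vertex (F.path c).1)) _ (hz c)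
    rwa [Nat.cast_zero, zero_add] at this
  refine ⟨y, ⟨hy, hv, ?_, h.indep hF hπy hv⟩, hπy⟩
  refine hC.span_eq_top (fun j hj p hp => h.eq_zero_of_neg hC hj hp) hy fun p => ?_
  have hp : π p ∈ LinearMap.range π := ⟨p, rfl⟩
  rw [h.range_eq, ← Finsupp.range_linearCombination] at hp
  obtain ⟨v, hv⟩ := hp
  refine ⟨Finsupp.linearCombination (Monomial K S) y v, ?_, h.ker_le ?_⟩
  · rw [← Finsupp.range_linearCombination]
    exact ⟨v, rfl⟩
  · rw [LinearMap.mem_ker, map_sub, sub_eq_zero, ← hv, Finsupp.apply_linearCombination]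
    congr 2
    exact (funext hπy).symm

/-- The kernel of a minimal cover is generated by the products of the paths in `next S p` with
the generators that belong to `p`. -/
theorem ker_eq_span (h : IsMinimalCover C π F x) {y : F.ι → P}
    (hy : IsFreeFamily (K := K) (S := S) C F y) (hπ : ∀ c, π (y c) = x c) :
    LinearMap.ker π = Submodule.span (Monomial K S)
      (Set.range fun c : (F.succ S).ι => pathClass K S c.2.1 • y c.1) := by
  refine le_antisymm (fun p hp => ?_) (Submodule.span_le.mpr ?_)
  · have hp' : p ∈ Submodule.span (Monomial K S) (Set.range y) := by
      rw [hy.span_eq_top]; exact Submodule.mem_top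
    rw [← Finsupp.range_linearCombination] at hp'
    obtain ⟨f, rfl⟩ := hp'
    have hf : Finsupp.linearCombination (Monomial K S) x f = 0 := by
      rw [← LinearMap.mem_ker.mp hp, Finsupp.apply_linearCombination]
      congr 2
      exact (funext hπ).symm
    rw [Finsupp.linearCombination_apply]
    refine Submodule.sum_mem _ fun c _ => ?_
    change f c • y c ∈ _
    -- Only the part of `f c` ending at the origin of the path acts on `y c`, and only this part
    -- lies in the ideal generated by `next S`.
    rw [← hy.vertex_smul c, ← mul_smul]
    have hmem := mul_vertex_mem_span ((h.relations f).mp hf c)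
    generalize f c * pathClass K S (vertex (F.path c).1) = a at hmem
    induction hmem using Submodule.span_induction with
    | zero => rw [zero_smul]; exact zero_mem _
    | add a b _ _ ha hb => rw [add_smul]; exact add_mem ha hb
    | smul r a _ ha => rw [smul_eq_mul, mul_smul]; exact Submodule.smul_mem _ r ha
    | mem a ha =>
      obtain ⟨q, hq, rfl⟩ := ha
      exact Submodule.subset_span ⟨⟨c, q, hq⟩, rfl⟩
  · rintro _ ⟨⟨c, q, hq⟩, rfl⟩
    change π (pathClass K S q • y c) = 0
    rw [map_smul, hπ]
    exact h.smul_eq_zero (pathClass_mem_annihilator hq)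

end IsMinimalCover

namespace IsFreeFamily

variable {y : F.ι → P}

/-- Independence of `y` splits a relation into one for each `c`. Within it, a given path ends in at
most one of the completions `q`, so the summands share no path and each product vanishes separately.
-/
theorem relations_succ (hy : IsFreeFamily (K := K) (S := S) C F y)
    (hF : ∀ c, F.path c ∉ through S) (f : (F.succ S).ι →₀ Monomial K S) :
    Finsupp.linearCombination (Monomial K S)
        (fun c : (F.succ S).ι => pathClass K S c.2.1 • y c.1) f = 0 ↔
      ∀ c, f c ∈ annihilator K S ((F.succ S).path c) := by
  classical
  have hl : ∀ c : (F.succ S).ι, c.2.1.length ≠ 0 := fun c =>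
    Nat.one_le_iff_ne_zero.mp (QuiverPath.length_pos_of_mem_next (hF c.1) c.2.2)
  constructor
  · rintro hf ⟨c, q, hq⟩
    refine (mul_pathClass_eq_zero_iff (hl ⟨c, q, hq⟩)).mp (eq_zero_of_coef fun b => ?_)
    by_contra hb
    obtain ⟨p, hpq, -⟩ := exists_isComp_of_coef_ne_zero hb
    have hsum : Finsupp.linearCombination (Monomial K S) y
        (∑ i ∈ f.support, Finsupp.single i.1 (f i * pathClass K S i.2.1)) = 0 := by
      rw [← hf, map_sum]
      refine Finset.sum_congr rfl fun i _ => ?_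
      rw [Finsupp.linearCombination_single, mul_smul]
      rfl
    have h0 := mul_vertex_eq_zero_iff.mp (hy.indep _ hsum c) b (hpq.target.trans hq.1)
    rw [Finsupp.finsetSum_apply, map_sum, Finset.sum_eq_single ⟨c, q, hq⟩] at h0
    · rw [Finsupp.single_eq_same] at h0
      exact hb h0
    · rintro ⟨c', q', hq'⟩ - hne
      by_cases hc : c' = c
      · subst hc
        rw [Finsupp.single_eq_same]
        by_contra hb'
        obtain ⟨p', hpq', -⟩ := exists_isComp_of_coef_ne_zero hb'
        obtain ⟨rfl, -⟩ := QuiverPath.next_suffix_unique hq' hq hpq' hpq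
        exact hne rfl
      · rw [Finsupp.single_eq_of_ne (Ne.symm hc), map_zero]
    · intro hn
      rw [Finsupp.notMem_support_iff.mp hn, zero_mul, Finsupp.single_zero, Finsupp.zero_apply,
        map_zero]
  · intro hf
    rw [Finsupp.linearCombination_apply]
    refine Finset.sum_eq_zero fun c _ => ?_
    change f c • pathClass K S c.2.1 • y c.1 = 0
    rw [← mul_smul, (mul_pathClass_eq_zero_iff (hl c)).mpr (hf c), zero_smul]

theorem mem_component_succ (hC : IsGrading (K := K) (S := S) C)
    (hy : IsFreeFamily (K := K) (S := S) C F y) (c : (F.succ S).ι) :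
    pathClass K S c.2.1 • y c.1 ∈ C ((F.succ S).deg c) := by
  have h := hC.smul_mem _ _ _ (ofPath_mem_homogeneous c.2.1) _ (hy.mem c.1)
  rw [← Nat.cast_add, add_comm] at h
  exact h

/-- Otherwise independence would put the vertex of `y c` into the arrow ideal. -/
theorem notMem_radical (hS : ∀ p ∈ S, 2 ≤ p.length)
    (hy : IsFreeFamily (K := K) (S := S) C F y) (c : F.ι) : y c ∉ radical K S P := by
  intro h
  have key : ∃ f : F.ι →₀ Monomial K S, (∀ c, f c ∈ order K S 1) ∧
      Finsupp.linearCombination (Monomial K S) y f = y c := by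
    refine Submodule.smul_induction_on h (fun a ha p _ => ?_) ?_
    · have hp : p ∈ Submodule.span (Monomial K S) (Set.range y) := by
        rw [hy.span_eq_top]; exact Submodule.mem_top
      rw [← Finsupp.range_linearCombination] at hp
      obtain ⟨f, rfl⟩ := hp
      exact ⟨a • f, fun c => mul_mem_order (mem_arrowIdeal_iff.mp ha) (mem_order_zero _),
        map_smul _ _ _⟩
    · rintro _ _ ⟨f, hf, rfl⟩ ⟨g, hg, rfl⟩
      exact ⟨f + g, fun c => add_mem (hf c) (hg c), map_add _ _ _⟩
  obtain ⟨f, hf, hfy⟩ := key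
  have h0 := hy.indep (f - Finsupp.single c 1)
    (by rw [map_sub, hfy, Finsupp.linearCombination_single, one_smul, sub_self]) c
  rw [Finsupp.sub_apply, Finsupp.single_eq_same, sub_mul, one_mul, sub_eq_zero] at h0
  refine vertex_notMem_order (K := K) hS (F.path c).1 ?_
  rw [← h0]
  exact mul_mem_order (hf c) (mem_order_zero _)

/-- If the degree of `y c` is not in `D`, reaching it from degrees in `D` takes paths of positive
length, which would put `y c` into the radical. -/
theorem span_homogeneous_eq_top_iff (hS : ∀ p ∈ S, 2 ≤ p.length)
    (hC : IsGrading (K := K) (S := S) C) (hy : IsFreeFamily (K := K) (S := S) C F y)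
    (D : Set ℤ) :
    Submodule.span (Monomial K S) {m : P | ∃ j ∈ D, m ∈ C j} = ⊤ ↔
      ∀ c, (F.deg c : ℤ) ∈ D := by
  constructor
  · intro h c
    by_contra hc
    refine hy.notMem_radical hS c ?_
    have h1 : y c ∈ AddSubgroup.closure (⋃ k, IsGrading.pathMultiples K S C 0 D k) := by
      have hyc : y c ∈ Submodule.span (Monomial K S) {m : P | ∃ j ∈ D, m ∈ C j} := by
        rw [h]; exact Submodule.mem_top
      refine Submodule.closure_induction (p := fun p _ => p ∈ AddSubgroup.closure
        (⋃ k, IsGrading.pathMultiples K S C 0 D k)) (zero_mem _) (fun _ _ _ _ => add_mem)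
        (fun a p hp => ?_) hyc
      obtain ⟨j, hj, hp⟩ := hp
      exact IsGrading.smul_mem_closure (mem_order_zero a) hj hp
    have h2 := mem_closure_of_mem_component hC.isInternal (hC.pathMultiples_subset 0 D)
      (hy.mem c) h1
    refine (AddSubgroup.closure_le (radical K S P).toAddSubgroup).mpr ?_ h2
    rintro _ ⟨b, a, j, p, -, hj, hp, hjc, rfl⟩
    refine smul_mem_radical (mk_smul_ofPath_mem_order ?_ a) p
    by_contra hb
    refine hc (hjc ▸ ?_)
    rwa [show b.length = 0 by omega, Nat.cast_zero, zero_add]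
  · intro h
    rw [eq_top_iff, ← hy.span_eq_top]
    refine Submodule.span_mono ?_
    rintro _ ⟨c, rfl⟩
    exact ⟨_, h c, hy.mem c⟩

end IsFreeFamily

end QuiverAlgebra

end

noncomputable section

open QuiverPath (IsComp through next vertex GradedFamily chains)

/-! ### The generators of an arbitrary minimal resolution. -/

namespace QuiverAlgebra

open PathAlgebra

variable {K : Type u} {V : Type v} [Field K] [Fintype V] [Quiver.{w} V] {S : Set (QuiverPath V)}

namespace MinimalGradedResolution

variable (R : MinimalGradedResolution (monomialIdeal K S))

theorem isGrading (n : ℕ) : IsGrading (K := K) (S := S) (R.component n) :=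
  ⟨R.isInternal n, R.smul_mem n⟩

/-- The images in `Λ₀` of the vertices. -/
def vertexClass (c : (chains S 0).ι) : degreeZero (monomialIdeal K S) :=
  (arrowIdeal (monomialIdeal K S)).mkQ (pathClass K S ((chains S 0).path c))

theorem isMinimalCover_zero : IsMinimalCover (R.component 0) R.ε (chains S 0)
    (vertexClass (K := K) (S := S)) where
  ker_le := (LinearMap.exact_iff.mp R.exact_zero).le.trans (R.minimal 0)
  range_eq := by
    rw [LinearMap.range_eq_top.mpr R.ε_surjective, eq_comm, eq_top_iff]
    rintro z -
    obtain ⟨a, rfl⟩ := Submodule.mkQ_surjective _ z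
    rw [← mul_one a, ← smul_eq_mul, map_smul]
    refine Submodule.smul_mem _ _ ?_
    rw [← map_one (QuiverAlgebra.mk (monomialIdeal K S)), one_def, map_sum, map_sum]
    exact Submodule.sum_mem _ fun x _ => Submodule.subset_span ⟨⟨vertex x, rfl⟩, rfl⟩
  relations f := by
    have h1 : Finsupp.linearCombination (Monomial K S) (vertexClass (K := K) (S := S)) f =
        (arrowIdeal (monomialIdeal K S)).mkQ
          (∑ c ∈ f.support, f c * pathClass K S ((chains S 0).path c)) := by
      rw [map_sum]
      rfl
    rw [h1, Submodule.mkQ_apply, Submodule.Quotient.mk_eq_zero, mem_arrowIdeal_iff]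
    rw [forall_congr' fun c : (chains S 0).ι =>
      mem_annihilator_of_length_zero (K := K) (S := S) (a := f c) (p := (chains S 0).path c) c.2]
    have hv : ∀ c : (chains S 0).ι,
        (chains S 0).path c = vertex ((chains S 0).path c).2.1 := fun c => QuiverPath.eq_vertex c.2
    constructor
    · intro h c
      by_cases hc : c ∈ f.support
      · have h2 := mul_mem_order h (mem_order_zero (pathClass K S ((chains S 0).path c)))
        rw [Finset.sum_mul, Finset.sum_eq_single c] at h2
        · rwa [mul_assoc, hv c, vertex_mul_vertex, ← hv c] at h2
        -- Distinct vertices are orthogonal idempotents.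
        · intro c' _ hne
          rw [mul_assoc, pathClass, pathClass, ← map_mul, ofPath_mul_of_ne, map_zero, mul_zero]
          intro he
          refine hne (Subtype.ext ((hv c').trans (Eq.trans ?_ (hv c).symm)))
          rw [he, hv c]
          rfl
        · exact fun hn => absurd hc hn
      · rw [Finsupp.notMem_support_iff.mp hc, zero_mul]
        exact zero_mem _
    · exact fun h => sum_mem fun c _ => h c
  exists_lift c := by
    obtain ⟨p, hp⟩ := R.ε_surjective (vertexClass c)
    suffices h : ∀ p, ∃ q ∈ R.component 0 0, R.ε q = R.ε p by
      obtain ⟨q, hq, hqp⟩ := h p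
      exact ⟨q, hq, hqp.trans hp⟩
    obtain ⟨f, hf, hf1, hf0⟩ := exists_projection (R.isInternal 0) 0
    -- The degree `0` part of any preimage works, since `ε` kills the other components.
    refine fun p => ⟨f p, hf p, ?_⟩
    refine eq_top_of_component_le (R.isInternal 0)
      (H := (R.ε.toAddMonoidHom.comp f).eqLocus R.ε.toAddMonoidHom) (fun j m hm => ?_) p
    change R.ε (f m) = R.ε m
    by_cases hj : j = 0
    · subst hj
      rw [hf1 m hm]
    · rw [hf0 j hj m hm, map_zero, R.ε_eq_zero j hj m hm]
  map_neg j hj p hp := R.ε_eq_zero j hj.ne p hp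

theorem isMinimalCover_succ {N : Type*} [AddCommGroup N] [Module (Monomial K S) N] {n : ℕ}
    {F : GradedFamily V} {x : F.ι → N} {π : R.P n →ₗ[Monomial K S] N}
    (hker : LinearMap.ker π = LinearMap.range (R.d n))
    (h : IsMinimalCover (R.component n) π F x) (hF : ∀ c, F.path c ∉ through S)
    {y : F.ι → R.P n} (hy : IsFreeFamily (K := K) (S := S) (R.component n) F y)
    (hπ : ∀ c, π (y c) = x c) :
    IsMinimalCover (R.component (n + 1)) (R.d n) (F.succ S)
      (fun c : (F.succ S).ι => pathClass K S c.2.1 • y c.1) where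
  ker_le := (LinearMap.exact_iff.mp (R.exact_succ n)).le.trans (R.minimal (n + 1))
  range_eq := by rw [← hker, h.ker_eq_span hy hπ]
  relations := hy.relations_succ hF
  exists_lift c := by
    have hc := hy.mem_component_succ (R.isGrading n) c
    have hc' : pathClass K S c.2.1 • y c.1 ∈ LinearMap.range (R.d n) := by
      rw [← hker, h.ker_eq_span hy hπ]
      exact Submodule.subset_span ⟨c, rfl⟩
    obtain ⟨p, hp⟩ := hc'
    obtain ⟨f, hf, hf1, hf0⟩ := exists_projection (R.isInternal (n + 1)) ((F.succ S).deg c)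
    obtain ⟨g, hg, hg1, hg0⟩ := exists_projection (R.isInternal n) ((F.succ S).deg c)
    refine ⟨f p, hf p, ?_⟩
    rw [← hg1 _ hc, ← hp]
    -- The projections onto one degree commute with the differential; it suffices to check this on
    -- homogeneous elements.
    refine eq_top_of_component_le (R.isInternal (n + 1))
      (H := ((R.d n).toAddMonoidHom.comp f).eqLocus (g.comp (R.d n).toAddMonoidHom))
      (fun j m hm => ?_) p
    change R.d n (f m) = g (R.d n m)
    by_cases hj : j = (F.succ S).deg c
    · subst hj
      rw [hf1 m hm, hg1 _ (R.d_mem n _ m hm)]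
    · rw [hf0 j hj m hm, map_zero, hg0 j hj _ (R.d_mem n j m hm)]
  map_neg j hj p hp := by
    have := R.projective n
    exact h.eq_zero_of_neg (R.isGrading n) hj (R.d_mem n j p hp)

/-- The induction carries the cover by `Pⁿ⁺¹` along: its lifted generators are the family of the
next stage. -/
theorem exists_isFreeFamily (hS : ∀ p ∈ S, 2 ≤ p.length) (n : ℕ) :
    ∃ y : (chains S n).ι → R.P n,
      IsFreeFamily (K := K) (S := S) (R.component n) (chains S n) y ∧
      IsMinimalCover (R.component (n + 1)) (R.d n) (chains S (n + 1))
        (fun c : ((chains S n).succ S).ι => pathClass K S c.2.1 • y c.1) := by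
  induction n with
  | zero =>
    have := R.projective 0
    have h := R.isMinimalCover_zero
    have hF := QuiverPath.chains_path_notMem hS 0
    obtain ⟨y, hy, hπ⟩ := h.exists_isFreeFamily (R.isGrading 0) hF
    exact ⟨y, hy, R.isMinimalCover_succ (LinearMap.exact_iff.mp R.exact_zero) h hF hy hπ⟩
  | succ n ih =>
    have := R.projective (n + 1)
    obtain ⟨x, -, h⟩ := ih
    have hF := QuiverPath.chains_path_notMem hS (n + 1)
    obtain ⟨y, hy, hπ⟩ := h.exists_isFreeFamily (R.isGrading (n + 1)) hF
    exact ⟨y, hy, R.isMinimalCover_succ (LinearMap.exact_iff.mp (R.exact_succ n)) h hF hy hπ⟩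

/-- The degrees of generators in a minimal resolution are the degrees of the chains. -/
theorem generatedInDegrees_iff (hS : ∀ p ∈ S, 2 ≤ p.length) (n : ℕ) (D : Set ℤ) :
    R.GeneratedInDegrees n D ↔ ∀ c, ((chains S n).deg c : ℤ) ∈ D := by
  obtain ⟨y, hy, -⟩ := R.exists_isFreeFamily hS n
  exact hy.span_homogeneous_eq_top_iff hS (R.isGrading n) D

end MinimalGradedResolution

end QuiverAlgebra

end

/-! ### The equivalence, as a statement about chains. -/

theorem corollary15 {K : Type u} {V : Type v} [Field K] [Fintype V] [Quiver.{w} V]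
    [∀ a b : V, Finite (a ⟶ b)] (d : ℕ) (hd : 2 < d) (S : Set (QuiverPath V))
    (hS : ∀ p ∈ S, p.length = 2 ∨ p.length = d)
    (R : QuiverAlgebra.MinimalGradedResolution (PathAlgebra.monomialIdeal K S)) :
    QuiverAlgebra.IsTwoDDetermined d (PathAlgebra.monomialIdeal K S) ↔
      R.GeneratedInDegrees 3 (Set.Iic ((d : ℤ) + 1)) := by
  have hS2 : ∀ p ∈ S, 2 ≤ p.length := fun p hp => by have := hS p hp; omega
  rw [R.generatedInDegrees_iff hS2]
  constructor
  -- `R'` may differ from `R`, but the degrees of both are those of the chains.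
  · rintro ⟨-, R', hR'⟩ c
    have h := ((R'.generatedInDegrees_iff hS2 3 _).mp (hR' 3) c).2
    have hδ : QuiverAlgebra.delta d 3 = d + 1 := by
      rw [QuiverAlgebra.delta, if_neg (by decide)]
      omega
    rw [hδ] at h
    change ((QuiverPath.chains S 3).deg c : ℤ) ≤ (d : ℤ) + 1
    exact_mod_cast h
  · intro h3
    have h3' : ∀ c : (QuiverPath.chains S 3).ι, (QuiverPath.chains S 3).deg c ≤ d + 1 :=
      fun c => by
        have h : ((QuiverPath.chains S 3).deg c : ℤ) ≤ (d : ℤ) + 1 := h3 c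
        exact_mod_cast h
    refine ⟨⟨PathAlgebra.ofPath K '' S, ?_, rfl⟩, R, fun n => ?_⟩
    · rintro _ ⟨p, hp, rfl⟩
      have h := PathAlgebra.ofPath_mem_homogeneous (K := K) p
      rcases hS p hp with hl | hl
      · exact Or.inl (hl ▸ h)
      · exact Or.inr (hl ▸ h)
    · refine (R.generatedInDegrees_iff hS2 n _).mpr fun c => ⟨?_, ?_⟩
      · exact_mod_cast QuiverPath.le_deg_chains hS2 n c
      · exact_mod_cast QuiverPath.deg_chains_le_delta hd hS h3' n c
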